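/- **Setting.** Let $d\ge 0$ and $q\ge 1$ be integers, $G_q\subset\mathbb C$ the group of $q$-th roots of unity, $\Omega=\prod_{x\in\mathbb Z^d}G_q$ with the product topology, and $G=\bigoplus_{x\in\mathbb Z^d}G_q$ with the discrete topology, acting on $\Omega$ by multiplication. Let $\mathcal G=\Omega\rtimes G$ be the transformation groupoid, whose arrow $(\sigma,g)$ has source $\sigma$ and range $g\sigma$. On $C_c(\mathcal G)$ consider the convolution $(f_1\cdot f_2)(\sigma,g)=\sum_{h\in G}f_1(h^{-1}g\sigma,h)f_2(\sigma,h^{-1}g)$, the involution $f^*(\sigma,g)=\overline{f(g\sigma,g^{-1})}$, and the left regular representation on $\ell^2(\mathcal G)=\bigoplus_{\sigma}\ell^2(\{\sigma\}\times G)$, $(\pi(f)\xi)(\sigma,k)=\sum_h f(h\sigma,kh^{-1})\xi(\sigma,h)$. Let $C^*(\mathcal G)$ be the completion of $C_c(\mathcal G)$ in the norm $\|\pi(f)\|$. For $\Lambda\subseteq\mathbb Z^d$, $C^*(\mathcal G_\Lambda)\subseteq C^*(\mathcal G)$ is the closure of the set of $f\in C_c(\mathcal G)$ such that $f(\sigma,g)$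 depends on $\sigma$ only through $\sigma_\Lambda$ and vanishes unless $\{x:g_x\ne1\}\subseteq\Lambda$. A function $f\in C(\Omega)$ is identified with $(\sigma,g)\mapsto f(\sigma)\delta_{g=1}$ in $C^*(\mathcal G)$, and $C(\Omega_\Lambda)\subseteq C(\Omega)$ consists of the functions of $\sigma_\Lambda$. Let $\mathbb E:C^*(\mathcal G)\to C(\Omega)$ be the bounded linear extension of $\mathbb E(f)(\sigma)=f(\sigma,1)$, $f\in C_c(\mathcal G)$. A state $\mu$ is *classical* if $\mu=\mu\circ\mathbb E$; its Riesz–Markov measure is the Borel probability measure $\nu$ on $\Omega$ with $\int f\,d\nu=\mu(f)$ for all $f\in C(\Omega)$. **Interactions.** An interaction is a family $\phi=(\phi_X)$, indexed by the finite $X\subset\mathbb Z^d$, with $\phi_X=\phi_X^*\in C^*(\mathcal G_X)$. It is *classical* if $\phi_X\in C(\Omega_X)$ for all $X$. We assume throughout that $\sum_{X\ni x}\|\phi_X\|<\infty$ for every $x\in\mathbb Z^d$. (This holds for every interaction for which some $R$ satisfies $\phi_X=0$ whenever $\operatorname{diam}X>R$, and for every $\phi$ with $\sum_{n\ge0}e^{\lambda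 n}\sup_x\sum_{X\ni x,\,|X|=n+1}\|\phi_X\|<\infty$ for some $\lambda>0$.) For finite $\Lambda$ put $$H_\Lambda=\sum_{X\subseteq\Lambda}\phi_X,\qquad W_\Lambda=\sum_{X\cap\Lambda\neq\emptyset,\;X\cap\Lambda^c\neq\emptyset}\phi_X,\qquad \mu_{\beta,\phi,\Lambda}(f)=\frac{\sum_{\sigma_\Lambda}(f\cdot e^{-\beta H_\Lambda})(\sigma_\Lambda,1)}{\sum_{\sigma_\Lambda}e^{-\beta H_\Lambda}(\sigma_\Lambda,1)}\quad(f\in C^*(\mathcal G_\Lambda)).$$ **Gibbs–Araki–Ion condition.** Let $\beta>0$ and let $\tau$ be the dynamics of $\phi$, i.e. the strongly continuous one-parameter group of $*$-automorphisms of $C^*(\mathcal G)$ whose generator is $f\mapsto i\sum_{X\cap\Lambda\ne\emptyset}[\phi_X,f]$ on $C^*(\mathcal G_\Lambda)$, $\Lambda$ finite. For a self-adjoint $P$ for which $t\mapsto\tau_t(P)$ extends analytically to a strip $|\operatorname{Im}z|<r$ with $r>s$, let $$E_{P,is}=\sum_{n\ge0}(-1)^n\int_{0<t_n<\dots<t_1<s}\tau_{it_n}(P)\cdots\tau_{it_1}(P)\,dt,\qquad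 \mu^P(f)=\frac{\mu\big((E_{P,i\beta/2})^*\cdot f\cdot E_{P,i\beta/2}\big)}{\mu\big((E_{P,i\beta/2})^*\cdot E_{P,i\beta/2}\big)}.$$ A state $\mu$ on $C^*(\mathcal G)$ satisfies the Gibbs–Araki–Ion condition for $\beta,\phi$ if the dynamics $\tau$ exists, $\mu$ is faithful ($\mu(a^*a)=0\Rightarrow a=0$), and for every finite $\Lambda\subset\mathbb Z^d$, with $P=-W_\Lambda$, the element $E_{P,i\beta/2}$ exists and $\mu^{P}=\mu_{\beta,\phi,\Lambda}\otimes\bar\mu$ for some state $\bar\mu$ on $C^*(\mathcal G_{\Lambda^c})$, i.e. $\mu^P(ab)=\mu_{\beta,\phi,\Lambda}(a)\bar\mu(b)$ for $a\in C^*(\mathcal G_\Lambda)$, $b\in C^*(\mathcal G_{\Lambda^c})$. **DLR equations.** For classical $\phi$, a probability measure $\nu$ on $\Omega$ satisfies the DLR equations for $\beta,\phi$ if for every finite $\Lambda$ and every $f\in C(\Omega)$, for $\nu$-almost every $\eta$, $$\mathbb E_\nu[f\mid\mathcal F_{\Lambda^c}](\eta)=\frac{\sum_{\sigma_\Lambda}f(\sigma_\Lambda\eta_{\Lambda^c})\,e^{-\beta(H_\Lambda(\sigma_\Lambda)+W_\Lambda(\sigma_\Lambda\eta_{\Lambda^c}))}}{\sum_{\sigma_\Lambda}e^{-\beta(H_\Lambda(\sigma_\Lambda)+W_\Lambda(\sigma_\Lambda\eta_{\Lambda^c}))}},$$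 where $\mathcal F_{\Lambda^c}$ is the $\sigma$-algebra generated by the coordinates outside $\Lambda$ and $\sigma_\Lambda$ runs over $\Omega_\Lambda=G_q^\Lambda$. **Theorem.** Let $\beta>0$ and let $\phi$ be a classical interaction with $\sum_{X\ni x}\|\phi_X\|<\infty$ for every $x\in\mathbb Z^d$. A state $\mu$ on $C^*(\mathcal G)$ satisfies the Gibbs–Araki–Ion condition for $\beta,\phi$ if and only if $\mu$ is classical and its Riesz–Markov measure satisfies the DLR equations for $\beta,\phi$. -/

import Mathlib

open scoped ComplexConjugate ComplexOrder CompactlySupported ENNReal Topology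
open Filter MeasureTheory

noncomputable section

namespace QSpin

/-! ### Lattice, configurations and the transformation groupoid -/

/-- The lattice `ℤᵈ`. -/
abbrev Lattice (d : ℕ) : Type := Fin d → ℤ

/-- The single-site space `G_q`: the group of `q`-th roots of unity. -/
abbrev Spin (q : ℕ) : Type := rootsOfUnity q ℂ

instance (q : ℕ) [NeZero q] : Fintype (Spin q) := Fintype.ofFinite _

/-- The configuration space `Ω = ∏_{x ∈ ℤᵈ} G_q` with the product topology. -/
abbrev Conf (d q : ℕ) : Type := Lattice d → Spin q

/-- The support `{x : g_x ≠ 1}` of a family of group elements. -/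
def spinSupp {d q : ℕ} (g : Conf d q) : Set (Lattice d) := {x | g x ≠ 1}

/-- The direct sum `⨁_{x ∈ ℤᵈ} G_q`, as a subgroup of the full product. -/
def flipSubgroup (d q : ℕ) : Subgroup (Conf d q) where
  carrier := {g | (spinSupp g).Finite}
  one_mem' := by simp [spinSupp]
  mul_mem' := by
    intro a b ha hb
    refine (Set.Finite.union ha hb).subset fun x hx => ?_
    by_contra h
    simp only [spinSupp, Set.mem_union, Set.mem_ofPred_eq, not_or, not_not] at h
    exact hx (by simp [h.1, h.2])
  inv_mem' := by
    intro a ha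
    simpa [spinSupp] using ha

/-- The direct sum `G = ⨁_{x ∈ ℤᵈ} G_q`; it carries the discrete topology (not the topology induced
from the product). -/
def Flip (d q : ℕ) : Type := flipSubgroup d q

instance (d q : ℕ) : Group (Flip d q) := inferInstanceAs (Group (flipSubgroup d q))

instance (d q : ℕ) : TopologicalSpace (Flip d q) := ⊥

instance (d q : ℕ) : DiscreteTopology (Flip d q) := ⟨rfl⟩

/-- The action `g σ = (g_x σ_x)_x` of `G` on `Ω`. -/
instance (d q : ℕ) : MulAction (Flip d q) (Conf d q) :=
  inferInstanceAs (MulAction (flipSubgroup d q) (Conf d q))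

/-- The underlying family `(g_x)_x` of `g ∈ G`. -/
def Flip.val {d q : ℕ} (g : Flip d q) : Conf d q := Subtype.val g

/-- `supp g = {x : g_x ≠ 1}`. -/
def Flip.supp {d q : ℕ} (g : Flip d q) : Set (Lattice d) := spinSupp g.val

theorem Flip.smul_apply {d q : ℕ} (g : Flip d q) (σ : Conf d q) (x : Lattice d) :
    (g • σ) x = g.val x * σ x := rfl

theorem Flip.mul_val {d q : ℕ} (g h : Flip d q) (x : Lattice d) :
    (g * h).val x = g.val x * h.val x := rfl

theorem Flip.inv_val {d q : ℕ} (g : Flip d q) (x : Lattice d) :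
    (g⁻¹).val x = (g.val x)⁻¹ := rfl

theorem Flip.one_val {d q : ℕ} (x : Lattice d) : (1 : Flip d q).val x = 1 := rfl

theorem Flip.continuous_smul {d q : ℕ} (g : Flip d q) :
    Continuous fun σ : Conf d q => g • σ := by
  refine continuous_pi fun x => ?_
  simp only [Flip.smul_apply]
  fun_prop

/-- The set of arrows of the transformation groupoid `𝒢 = Ω ⋊ G`, with the product topology. The
arrow `(σ, g)` has source `σ` and range `g σ`. -/
abbrev Arrow (d q : ℕ) : Type := Conf d q × Flip d q

/-! ### The convolution algebra `C_c(𝒢)` -/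

section Cc

variable {d q : ℕ}

/-- The finite set of the `g` with `f(·, g) ≠ 0`. -/
theorem finite_flips (f : C_c(Arrow d q, ℂ)) : {g : Flip d q | ∃ σ, f (σ, g) ≠ 0}.Finite := by
  have h : IsCompact (Prod.snd '' tsupport f) := f.hasCompactSupport.isCompact.image continuous_snd
  refine h.finite_of_discrete.subset ?_
  rintro g ⟨σ, hσ⟩
  exact ⟨(σ, g), subset_tsupport _ hσ, rfl⟩

def flips (f : C_c(Arrow d q, ℂ)) : Finset (Flip d q) := (finite_flips f).toFinset

theorem apply_eq_zero (f : C_c(Arrow d q, ℂ)) {g : Flip d q} (hg : g ∉ flips f) (σ : Conf d q) :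
    f (σ, g) = 0 := by
  by_contra h
  exact hg (by simpa [flips] using ⟨σ, h⟩)

/-- A function on `𝒢` that is continuous in `σ` and vanishes unless `g` lies in a given finite set
is continuous with compact support. -/
def mkCc [NeZero q] (F : Conf d q → Flip d q → ℂ) (hc : ∀ g, Continuous fun σ => F σ g)
    (S : Finset (Flip d q)) (hS : ∀ σ, ∀ g ∉ S, F σ g = 0) : C_c(Arrow d q, ℂ) where
  toFun p := F p.1 p.2
  continuous_toFun := continuous_prod_of_discrete_right.2 hc
  hasCompactSupport' := by
    refine HasCompactSupport.intro (K := (Set.univ : Set (Conf d q)) ×ˢ (S : Set (Flip d q)))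
      (isCompact_univ.prod S.finite_toSet.isCompact) ?_
    rintro ⟨σ, g⟩ h
    exact hS σ g (by simpa using h)

theorem continuous_left (f : C_c(Arrow d q, ℂ)) (g : Flip d q) : Continuous fun σ => f (σ, g) :=
  (map_continuous f).comp (by fun_prop)

open scoped Classical in
/-- The convolution product
`(f₁ · f₂)(σ, g) = ∑_{(ω, h) : h ω = g σ} f₁(ω, h) f₂(σ, h⁻¹ g)`; here `ω = h⁻¹ g σ`, and the sum is
restricted to the finitely many `h` for which `f₁(·, h)` is not zero. -/
def conv [NeZero q] (f₁ f₂ : C_c(Arrow d q, ℂ)) : C_c(Arrow d q, ℂ) :=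
  mkCc (fun σ g => ∑ h ∈ flips f₁, f₁ ((h⁻¹ * g) • σ, h) * f₂ (σ, h⁻¹ * g))
    (fun g => continuous_finsetSum _ fun h _ =>
      ((continuous_left f₁ h).comp (Flip.continuous_smul _)).mul (continuous_left f₂ _))
    ((flips f₁ ×ˢ flips f₂).image fun p => p.1 * p.2)
    (by
      intro σ g hg
      refine Finset.sum_eq_zero fun h hh => ?_
      rw [apply_eq_zero f₂ (g := h⁻¹ * g), mul_zero]
      intro h2
      exact hg (Finset.mem_image.2 ⟨(h, h⁻¹ * g), by simp [hh, h2], by simp⟩))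

open scoped Classical in
/-- The involution `f^*(σ, g) = conj f(g σ, g⁻¹)`. -/
def adj [NeZero q] (f : C_c(Arrow d q, ℂ)) : C_c(Arrow d q, ℂ) :=
  mkCc (fun σ g => conj (f (g • σ, g⁻¹)))
    (fun g => Complex.continuous_conj.comp
      ((continuous_left f g⁻¹).comp (Flip.continuous_smul g)))
    ((flips f).image fun g => g⁻¹)
    (by
      intro σ g hg
      rw [apply_eq_zero f (g := g⁻¹), map_zero]
      intro h
      exact hg (Finset.mem_image.2 ⟨g⁻¹, h, by simp⟩))

open scoped Classical in
/-- The extension `f(σ, g) = f(σ) δ_{g = 1}` of `f ∈ C(Ω)` to the groupoid. -/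
def unitExt [NeZero q] (f : C(Conf d q, ℂ)) : C_c(Arrow d q, ℂ) :=
  mkCc (fun σ g => if g = 1 then f σ else 0)
    (fun g => by by_cases hg : g = 1 <;> simp only [hg, if_true, if_false] <;> fun_prop)
    {1} (by intro σ g hg; simpa using fun h => absurd h (by simpa using hg))

end Cc

/-! ### The left regular representation -/

section Rep

variable {d q : ℕ}

/-- The Hilbert space `ℓ²(𝒢) = ⨁_σ ℓ²(𝒢_σ)`. -/
abbrev GHilbert (d q : ℕ) : Type := lp (fun _ : Arrow d q => ℂ) 2

/-- The bijection `(σ, k) ↦ (σ, g⁻¹ k)` of `𝒢`. -/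
def translate (g : Flip d q) : Arrow d q ≃ Arrow d q where
  toFun p := (p.1, g⁻¹ * p.2)
  invFun p := (p.1, g * p.2)
  left_inv p := by simp
  right_inv p := by simp

theorem memlp_weighted (b : Arrow d q → ℂ) (C : ℝ) (hb : ∀ p, ‖b p‖ ≤ C)
    (e : Arrow d q ≃ Arrow d q) (ξ : GHilbert d q) :
    Memℓp (fun p => b p * ξ (e p)) 2 := by
  have h1 : Summable fun p => ‖ξ p‖ ^ (2 : ℝ≥0∞).toReal :=
    (memℓp_gen_iff (by norm_num)).1 (lp.memℓp ξ)
  have h2 := (e.summable_iff.2 h1).mul_left (C ^ 2)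
  refine memℓp_gen (h2.of_nonneg_of_le (fun p => by positivity) fun p => ?_)
  simp only [ENNReal.toReal_ofNat, Real.rpow_ofNat, Function.comp, norm_mul, mul_pow]
  gcongr
  exact hb p

/-- The weighted composition operator `ξ ↦ b · (ξ ∘ e)` on `ℓ²(𝒢)`. -/
def weighted (b : Arrow d q → ℂ) (C : ℝ) (hb : ∀ p, ‖b p‖ ≤ C)
    (e : Arrow d q ≃ Arrow d q) : GHilbert d q →L[ℂ] GHilbert d q :=
  LinearMap.mkContinuous
    { toFun := fun ξ => (⟨fun p => b p * ξ (e p), memlp_weighted b C hb e ξ⟩ : GHilbert d q)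
      map_add' := by
        intro ξ η
        ext p
        exact mul_add _ _ _
      map_smul' := by
        intro c ξ
        ext p
        exact mul_left_comm _ _ _ } C
    (by
      intro ξ
      have hC : 0 ≤ C := (norm_nonneg _).trans (hb (1, 1))
      refine lp.norm_le_of_tsum_le (by norm_num) (by positivity) ?_
      have h1 : Summable fun p => ‖ξ p‖ ^ (2 : ℝ≥0∞).toReal :=
        (memℓp_gen_iff (by norm_num)).1 (lp.memℓp ξ)
      have h2 := (e.summable_iff.2 h1).mul_left (C ^ 2)
      have h3 : ∀ p, ‖b p * ξ (e p)‖ ^ (2 : ℝ≥0∞).toReal ≤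
          C ^ 2 * ((fun p => ‖ξ p‖ ^ (2 : ℝ≥0∞).toReal) ∘ e) p := by
        intro p
        simp only [ENNReal.toReal_ofNat, Real.rpow_ofNat, Function.comp, norm_mul, mul_pow]
        gcongr
        exact hb p
      calc ∑' p, ‖b p * ξ (e p)‖ ^ (2 : ℝ≥0∞).toReal
          ≤ ∑' p, C ^ 2 * ((fun p => ‖ξ p‖ ^ (2 : ℝ≥0∞).toReal) ∘ e) p :=
            Summable.tsum_le_tsum h3
              (h2.of_nonneg_of_le (fun p => by positivity) h3) h2
        _ = C ^ 2 * ‖ξ‖ ^ (2 : ℝ≥0∞).toReal := by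
            rw [tsum_mul_left, lp.norm_rpow_eq_tsum (by norm_num) ξ]
            congr 1
            exact e.tsum_eq fun p => ‖ξ p‖ ^ (2 : ℝ≥0∞).toReal
        _ = (C * ‖ξ‖) ^ (2 : ℝ≥0∞).toReal := by
            simp [mul_pow])

theorem weighted_apply (b : Arrow d q → ℂ) (C : ℝ) (hb : ∀ p, ‖b p‖ ≤ C)
    (e : Arrow d q ≃ Arrow d q) (ξ : GHilbert d q) (p : Arrow d q) :
    weighted b C hb e ξ p = b p * ξ (e p) := rfl

theorem exists_bound (f : C_c(Arrow d q, ℂ)) : ∃ C : ℝ, ∀ p, ‖f p‖ ≤ C := by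
  obtain ⟨C, hC⟩ := f.hasCompactSupport.exists_bound_of_continuous (map_continuous f)
  exact ⟨C, hC⟩

/-- The left regular representation `π : C_c(𝒢) → B(ℓ²(𝒢))`. On each `ℓ²(𝒢_σ)` it is
`(π(f) ξ)(σ, k) = ∑_h f(h σ, k h⁻¹) ξ(σ, h)`, written with `g = k h⁻¹`, i.e. `h = g⁻¹ k`. -/
def rep (f : C_c(Arrow d q, ℂ)) : GHilbert d q →L[ℂ] GHilbert d q :=
  ∑ g ∈ flips f, weighted (fun p => f ((g⁻¹ * p.2) • p.1, g)) (exists_bound f).choose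
    (fun _ => (exists_bound f).choose_spec _) (translate g)

theorem rep_apply_of_subset (f : C_c(Arrow d q, ℂ)) (S : Finset (Flip d q)) (hS : flips f ⊆ S)
    (ξ : GHilbert d q) (σ : Conf d q) (k : Flip d q) :
    rep f ξ (σ, k) = ∑ g ∈ S, f ((g⁻¹ * k) • σ, g) * ξ (σ, g⁻¹ * k) := by
  rw [← Finset.sum_subset hS]
  · simp only [rep, FunLike.coe_sum, Finset.sum_apply, lp.coeFn_sum, weighted_apply]
    rfl
  · intro g _ hg
    rw [apply_eq_zero f hg, zero_mul]

/-- The defining formula `(π(f) ξ)(σ, k) = ∑_h f(h σ, k h⁻¹) ξ(σ, h)`. -/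
theorem rep_apply (f : C_c(Arrow d q, ℂ)) (ξ : GHilbert d q) (σ : Conf d q) (k : Flip d q) :
    rep f ξ (σ, k) = ∑ᶠ h, f (h • σ, k * h⁻¹) * ξ (σ, h) := by
  rw [rep_apply_of_subset f _ subset_rfl, ← finsum_eq_sum_of_support_subset]
  · refine finsum_eq_of_bijective (fun g => g⁻¹ * k) ?_ fun g => by simp
    exact ((Equiv.inv _).trans (Equiv.mulRight k)).bijective
  · intro g hg
    by_contra h
    exact hg (by simp only [apply_eq_zero f (by simpa using h), zero_mul])

theorem rep_add (f₁ f₂ : C_c(Arrow d q, ℂ)) : rep (f₁ + f₂) = rep f₁ + rep f₂ := by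
  classical
  ext ξ ⟨σ, k⟩
  have h : flips (f₁ + f₂) ⊆ flips f₁ ∪ flips f₂ := by
    intro g hg
    by_contra hn
    simp only [Finset.mem_union, not_or] at hn
    simp [flips, apply_eq_zero _ hn.1, apply_eq_zero _ hn.2] at hg
  simp only [_root_.add_apply, lp.coeFn_add, Pi.add_apply]
  rw [rep_apply_of_subset _ _ h, rep_apply_of_subset f₁ _ Finset.subset_union_left,
    rep_apply_of_subset f₂ _ Finset.subset_union_right, ← Finset.sum_add_distrib]
  exact Finset.sum_congr rfl fun g _ => by simp [add_mul]

theorem flips_subset_of (f : C_c(Arrow d q, ℂ)) (S : Finset (Flip d q))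
    (hS : ∀ σ, ∀ g ∉ S, f (σ, g) = 0) : flips f ⊆ S := by
  intro g hg
  by_contra h
  obtain ⟨σ, hσ⟩ : ∃ σ, f (σ, g) ≠ 0 := by simpa [flips] using hg
  exact hσ (hS σ g h)

variable [NeZero q]

theorem mkCc_apply (F : Conf d q → Flip d q → ℂ) (hc : ∀ g, Continuous fun σ => F σ g)
    (S : Finset (Flip d q)) (hS : ∀ σ, ∀ g ∉ S, F σ g = 0) (σ : Conf d q) (g : Flip d q) :
    mkCc F hc S hS (σ, g) = F σ g := rfl

theorem conv_apply (f₁ f₂ : C_c(Arrow d q, ℂ)) (σ : Conf d q) (g : Flip d q) :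
    conv f₁ f₂ (σ, g) = ∑ h ∈ flips f₁, f₁ ((h⁻¹ * g) • σ, h) * f₂ (σ, h⁻¹ * g) := rfl

theorem adj_apply (f : C_c(Arrow d q, ℂ)) (σ : Conf d q) (g : Flip d q) :
    adj f (σ, g) = conj (f (g • σ, g⁻¹)) := rfl

open scoped Classical in
theorem unitExt_apply (f : C(Conf d q, ℂ)) (σ : Conf d q) (g : Flip d q) :
    unitExt f (σ, g) = if g = 1 then f σ else 0 := rfl

theorem rep_conv (f₁ f₂ : C_c(Arrow d q, ℂ)) : rep (conv f₁ f₂) = rep f₁ * rep f₂ := by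
  classical
  ext ξ ⟨σ, k⟩
  have hsub : flips (conv f₁ f₂) ⊆ (flips f₁ ×ˢ flips f₂).image fun p => p.1 * p.2 := by
    refine flips_subset_of _ _ fun σ g hg => ?_
    rw [conv_apply]
    refine Finset.sum_eq_zero fun h hh => ?_
    rw [apply_eq_zero f₂ (g := h⁻¹ * g), mul_zero]
    intro h2
    exact hg (Finset.mem_image.2 ⟨(h, h⁻¹ * g), by simp [hh, h2], by simp⟩)
  rw [rep_apply_of_subset _ _ hsub]
  change _ = rep f₁ (rep f₂ ξ) (σ, k)
  rw [rep_apply_of_subset f₁ _ subset_rfl]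
  simp only [conv_apply, Finset.sum_mul]
  rw [Finset.sum_comm]
  refine Finset.sum_congr rfl fun h hh => ?_
  rw [rep_apply_of_subset f₂ _ subset_rfl, Finset.mul_sum]
  refine (Finset.sum_of_injOn (fun g' => h * g') (fun a _ b _ hab => mul_left_cancel hab) ?_ ?_
    ?_).symm
  · intro g' hg'
    exact Finset.mem_coe.2 (Finset.mem_image.2 ⟨(h, g'), by simpa [hh] using hg', rfl⟩)
  · intro g _ hg
    rw [apply_eq_zero f₂ (g := h⁻¹ * g)]
    · simp
    · intro h2
      exact hg ⟨h⁻¹ * g, h2, by simp⟩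
  · intro g' _
    simp [mul_assoc, smul_smul]

theorem rep_adj (f : C_c(Arrow d q, ℂ)) : rep (adj f) = star (rep f) := by
  classical
  rw [ContinuousLinearMap.star_eq_adjoint, ContinuousLinearMap.eq_adjoint_iff]
  intro ξ η
  have hsub : flips (adj f) ⊆ (flips f).image fun g => g⁻¹ := by
    refine flips_subset_of _ _ fun σ g hg => ?_
    rw [adj_apply, apply_eq_zero f (g := g⁻¹), map_zero]
    intro h
    exact hg (Finset.mem_image.2 ⟨g⁻¹, h, by simp⟩)
  have hop : rep (adj f) = ∑ g ∈ flips f, weighted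
      (fun p => conj (f (p.2 • p.1, g))) (exists_bound f).choose
      (fun _ => by simpa using (exists_bound f).choose_spec _) (translate g).symm := by
    ext ζ ⟨σ, k⟩
    rw [rep_apply_of_subset _ _ hsub, Finset.sum_image (fun a _ b _ h => inv_injective h)]
    simp only [FunLike.coe_sum, Finset.sum_apply, lp.coeFn_sum, weighted_apply, adj_apply]
    refine Finset.sum_congr rfl fun g _ => ?_
    simp [translate, smul_smul]
  rw [hop, rep]
  simp only [FunLike.coe_sum, Finset.sum_apply, sum_inner, inner_sum]
  refine Finset.sum_congr rfl fun g _ => ?_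
  rw [lp.inner_eq_tsum, lp.inner_eq_tsum, ← (translate g).tsum_eq]
  refine tsum_congr fun p => ?_
  simp [weighted_apply, translate, mul_comm, mul_left_comm]

theorem rep_unitExt_const (c : ℂ) :
    rep (unitExt (ContinuousMap.const (Conf d q) c)) = algebraMap ℂ _ c := by
  classical
  ext ξ ⟨σ, k⟩
  rw [rep_apply_of_subset _ {1} (flips_subset_of _ _ fun σ g hg => by
    rw [unitExt_apply, if_neg (by simpa using hg)])]
  simp [unitExt_apply, Algebra.algebraMap_eq_smul_one]

end Rep

/-! ### The groupoid C*-algebra and its local subalgebras -/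

section Algebra

variable {d q : ℕ}

/-- `f ∈ C_c(𝒢_Λ)`, regarded as a function on `𝒢` through
`f(σ, g) = f(σ_Λ, g_Λ) δ_{g_{Λᶜ} = 1}`. -/
def IsLocal (Λ : Set (Lattice d)) (f : C_c(Arrow d q, ℂ)) : Prop :=
  (∀ σ g, ¬ g.supp ⊆ Λ → f (σ, g) = 0) ∧
    ∀ σ σ' g, (∀ x ∈ Λ, σ x = σ' x) → f (σ, g) = f (σ', g)

theorem isLocal_univ (f : C_c(Arrow d q, ℂ)) : IsLocal Set.univ f :=
  ⟨fun _ _ h => absurd (Set.subset_univ _) h, fun σ σ' g h => by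
    rw [show σ = σ' from funext fun x => h x trivial]⟩

open scoped Classical in
/-- The diagonal matrix element `⟨δ_{(σ,1)}, a δ_{(σ,1)}⟩`. -/
def diagEntry (a : GHilbert d q →L[ℂ] GHilbert d q) (σ : Conf d q) : ℂ :=
  inner ℂ (lp.single 2 (σ, 1) 1 : GHilbert d q) (a (lp.single 2 (σ, 1) 1))

theorem diagEntry_rep (f : C_c(Arrow d q, ℂ)) (σ : Conf d q) :
    diagEntry (rep f) σ = f (σ, 1) := by
  classical
  rw [diagEntry, lp.inner_single_left, rep_apply, finsum_eq_single _ 1]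
  · simp
  · intro h hh
    simp [lp.single_apply, hh]

theorem norm_diagEntry_le (a : GHilbert d q →L[ℂ] GHilbert d q) (σ : Conf d q) :
    ‖diagEntry a σ‖ ≤ ‖a‖ := by
  classical
  have h1 : ‖(lp.single 2 (σ, 1) 1 : GHilbert d q)‖ = 1 := by
    rw [lp.norm_single (by norm_num)]
    simp
  calc ‖diagEntry a σ‖ ≤ ‖(lp.single 2 (σ, 1) 1 : GHilbert d q)‖ *
        ‖a (lp.single 2 (σ, 1) 1 : GHilbert d q)‖ := norm_inner_le_norm _ _
    _ ≤ ‖a‖ := by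
      rw [h1, one_mul]
      simpa [h1] using a.le_opNorm (lp.single 2 (σ, 1) 1 : GHilbert d q)

theorem diagEntry_sub (a b : GHilbert d q →L[ℂ] GHilbert d q) (σ : Conf d q) :
    diagEntry (a - b) σ = diagEntry a σ - diagEntry b σ := by
  simp [diagEntry]

variable [NeZero q]

/-- The `*`-algebra `π(C_c(𝒢_Λ))`. -/
def repAlg (d q : ℕ) [NeZero q] (Λ : Set (Lattice d)) :
    StarSubalgebra ℂ (GHilbert d q →L[ℂ] GHilbert d q) where
  carrier := {T | ∃ f, IsLocal Λ f ∧ rep f = T}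
  mul_mem' := by
    rintro _ _ ⟨f₁, h₁, rfl⟩ ⟨f₂, h₂, rfl⟩
    refine ⟨conv f₁ f₂, ⟨fun σ g hg => ?_, fun σ σ' g hσ => ?_⟩, rep_conv f₁ f₂⟩
    · rw [conv_apply]
      refine Finset.sum_eq_zero fun h _ => ?_
      by_cases hh : h.supp ⊆ Λ
      · rw [h₂.1 σ (h⁻¹ * g), mul_zero]
        intro hhg
        refine hg fun x hx => ?_
        by_contra hxΛ
        have e1 : h.val x = 1 := by
          by_contra hne
          exact hxΛ (hh hne)
        have e2 : (h⁻¹ * g).val x = 1 := by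
          by_contra hne
          exact hxΛ (hhg hne)
        rw [Flip.mul_val, Flip.inv_val, e1] at e2
        exact hx (by simpa using e2)
      · rw [h₁.1 _ _ hh, zero_mul]
    · rw [conv_apply, conv_apply]
      refine Finset.sum_congr rfl fun h _ => ?_
      rw [h₂.2 σ σ' _ hσ, h₁.2 _ ((h⁻¹ * g) • σ') h fun x hx => by
        rw [Flip.smul_apply, Flip.smul_apply, hσ x hx]]
  add_mem' := by
    rintro _ _ ⟨f₁, h₁, rfl⟩ ⟨f₂, h₂, rfl⟩
    refine ⟨f₁ + f₂, ⟨fun σ g hg => ?_, fun σ σ' g hσ => ?_⟩, rep_add f₁ f₂⟩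
    · simp [h₁.1 σ g hg, h₂.1 σ g hg]
    · simp [h₁.2 σ σ' g hσ, h₂.2 σ σ' g hσ]
  algebraMap_mem' c := by
    refine ⟨unitExt (ContinuousMap.const _ c), ⟨fun σ g hg => ?_, fun σ σ' g _ => ?_⟩,
      rep_unitExt_const c⟩
    · rw [unitExt_apply, if_neg]
      rintro rfl
      exact hg fun x hx => absurd (Flip.one_val x) hx
    · simp [unitExt_apply]
  star_mem' := by
    rintro _ ⟨f, hf, rfl⟩
    refine ⟨adj f, ⟨fun σ g hg => ?_, fun σ σ' g hσ => ?_⟩, rep_adj f⟩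
    · rw [adj_apply, hf.1, map_zero]
      intro h
      exact hg fun x hx => h (by simpa [Flip.supp, spinSupp, Flip.inv_val] using hx)
    · rw [adj_apply, adj_apply, hf.2 (g • σ) (g • σ') g⁻¹ fun x hx => by
        rw [Flip.smul_apply, Flip.smul_apply, hσ x hx]]

/-- The reduced groupoid C*-algebra `C*(𝒢)`: the completion of `C_c(𝒢)` in the norm
`‖f‖_r = ‖π(f)‖`, realised as the norm closure of `π(C_c(𝒢))` in `B(ℓ²(𝒢))`. -/
abbrev CStarG (d q : ℕ) [NeZero q] : Type := (repAlg d q Set.univ).topologicalClosure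

/-- The C*-algebra `C*(𝒢_Λ)` as a subalgebra of `C*(𝒢)`, for an arbitrary `Λ ⊆ ℤᵈ`. -/
def localAlg (d q : ℕ) [NeZero q] (Λ : Set (Lattice d)) : StarSubalgebra ℂ (CStarG d q) :=
  (repAlg d q Λ).topologicalClosure.comap (repAlg d q Set.univ).topologicalClosure.subtype

/-- `f ∈ C_c(𝒢)` as an element of `C*(𝒢)`. -/
def ofCc (f : C_c(Arrow d q, ℂ)) : CStarG d q :=
  ⟨rep f, StarSubalgebra.le_topologicalClosure _ ⟨f, isLocal_univ f, rfl⟩⟩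

/-- The embedding `C(Ω) ⊆ C*(𝒢)`. -/
def ofCont (f : C(Conf d q, ℂ)) : CStarG d q := ofCc (unitExt f)

theorem continuous_diagEntry (a : CStarG d q) : Continuous (diagEntry a.1) := by
  refine continuous_of_uniform_approx_of_continuous fun u hu => ?_
  obtain ⟨ε, hε, hεu⟩ := Metric.mem_uniformity_dist.1 hu
  obtain ⟨_, ⟨f, -, rfl⟩, hf⟩ := Metric.mem_closure_iff.1 a.2 ε hε
  refine ⟨fun σ => f (σ, 1), continuous_left f 1, fun σ => hεu ?_⟩
  change dist _ (f (σ, 1)) < ε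
  rw [← diagEntry_rep, dist_eq_norm, ← diagEntry_sub]
  exact (norm_diagEntry_le _ _).trans_lt (by rwa [← dist_eq_norm])

/-- The conditional expectation `𝔼 : C*(𝒢) → C(Ω)`, the bounded linear extension of
`𝔼(f)(σ) = f(σ, 1)`, `f ∈ C_c(𝒢)`. -/
def condE : CStarG d q →L[ℂ] C(Conf d q, ℂ) :=
  LinearMap.mkContinuous
    { toFun := fun a => ⟨diagEntry a.1, continuous_diagEntry a⟩
      map_add' := fun a b => by
        ext σ
        simp [diagEntry]
      map_smul' := fun c a => by
        ext σ
        simp [diagEntry] } 1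
    fun a => by
      rw [one_mul]
      exact (ContinuousMap.norm_le _ (norm_nonneg _)).2 fun σ => norm_diagEntry_le a.1 σ

theorem condE_ofCc (f : C_c(Arrow d q, ℂ)) (σ : Conf d q) : condE (ofCc f) σ = f (σ, 1) :=
  diagEntry_rep f σ

end Algebra

/-! ### States -/

/-- A state: a positive linear functional of value one at the unit. -/
structure IsState {A : Type*} [NormedRing A] [StarRing A] [NormedAlgebra ℂ A]
    (μ : A →L[ℂ] ℂ) : Prop where
  pos : ∀ a, 0 ≤ μ (star a * a)
  map_one : μ 1 = 1

section Physics

variable {d q : ℕ} [NeZero q]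

/-- A state is classical if `μ = μ ∘ 𝔼`. -/
def IsClassicalState (μ : CStarG d q →L[ℂ] ℂ) : Prop :=
  ∀ a, μ a = μ (ofCont (condE a))

/-- `ν` is the Riesz--Markov measure of `μ`: `∫ f dν = μ(f)` for all `f ∈ C(Ω)`. -/
def IsRieszMarkov (μ : CStarG d q →L[ℂ] ℂ) (ν : Measure (Conf d q)) : Prop :=
  IsProbabilityMeasure ν ∧ ∀ f : C(Conf d q, ℂ), ∫ σ, f σ ∂ν = μ (ofCont f)

/-! ### Interactions -/

/-- An interaction: a family `φ_X = φ_X^* ∈ C*(𝒢_X)` indexed by the finite `X ⊂ ℤᵈ`. -/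
structure Interaction (d q : ℕ) [NeZero q] where
  toFun : Finset (Lattice d) → CStarG d q
  selfAdj : ∀ X, IsSelfAdjoint (toFun X)
  isLocal : ∀ X : Finset (Lattice d), toFun X ∈ localAlg d q (X : Set (Lattice d))

namespace Interaction

/-- `∑_{X ∋ x} ‖φ_X‖ < ∞` for every site `x`. -/
def IsSummable (φ : Interaction d q) : Prop :=
  ∀ x, Summable fun X : {X : Finset (Lattice d) // x ∈ X} => ‖φ.toFun X‖

/-- `φ` is classical: `φ_X ∈ C(Ω_X)` for all `X`. -/
def IsClassical (φ : Interaction d q) : Prop :=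
  ∀ X, ∃ f : C(Conf d q, ℂ),
    (∀ σ σ' : Conf d q, (∀ x ∈ X, σ x = σ' x) → f σ = f σ') ∧ φ.toFun X = ofCont f

/-- The Hamiltonian with empty boundary condition, `H_Λ = ∑_{X ⊆ Λ} φ_X`. -/
def hamiltonian (φ : Interaction d q) (Λ : Finset (Lattice d)) : CStarG d q :=
  ∑ X ∈ Λ.powerset, φ.toFun X

/-- `X` meets both `Λ` and its complement. -/
def Straddles (X Λ : Finset (Lattice d)) : Prop := (∃ x ∈ X, x ∈ Λ) ∧ ∃ x ∈ X, x ∉ Λ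

/-- The surface energy `W_Λ = ∑_{X ∩ Λ ≠ ∅, X ∩ Λᶜ ≠ ∅} φ_X`. -/
def surfaceEnergy (φ : Interaction d q) (Λ : Finset (Lattice d)) : CStarG d q :=
  ∑' X : {X : Finset (Lattice d) // Straddles X Λ}, φ.toFun X

/-- The derivation `𝒟^φ(f) = i ∑_{X ∩ Λ ≠ ∅} [φ_X, f]` for `f ∈ C*(𝒢_Λ)`. -/
def derivation (φ : Interaction d q) (Λ : Finset (Lattice d)) (f : CStarG d q) : CStarG d q :=
  Complex.I • ∑' X : {X : Finset (Lattice d) // ∃ x ∈ X, x ∈ Λ},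
    (φ.toFun X * f - f * φ.toFun X)

/-- `τ` is the infinite-volume dynamics of `φ`: a strongly continuous one-parameter group of
`*`-automorphisms of `C*(𝒢)` whose generator is given by `𝒟` on the local algebras. (Each `τ t` is
an automorphism, with inverse `τ (-t)`.) -/
structure IsDynamics (φ : Interaction d q) (τ : ℝ → (CStarG d q →⋆ₐ[ℂ] CStarG d q)) : Prop where
  map_zero : ∀ f, τ 0 f = f
  map_add : ∀ s t f, τ (s + t) f = τ s (τ t f)
  continuous : ∀ f, Continuous fun t => τ t f
  generator : ∀ Λ : Finset (Lattice d), ∀ f ∈ localAlg d q (Λ : Set (Lattice d)),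
    HasDerivAt (fun t => τ t f) (φ.derivation Λ f) 0

/-! ### Classical finite-volume Gibbs measures and the DLR equations -/

/-- The configuration `σ_Λ η_{Λᶜ}`. -/
def glue (Λ : Finset (Lattice d)) (σ : Λ → Spin q) (η : Conf d q) : Conf d q :=
  fun x => if h : x ∈ Λ then σ ⟨x, h⟩ else η x

/-- The value `φ_X(σ)` of a classical interaction at a configuration. -/
def value (φ : Interaction d q) (X : Finset (Lattice d)) (σ : Conf d q) : ℝ :=
  (condE (φ.toFun X) σ).re

/-- `H_Λ^η(σ_Λ) = ∑_{X ⊆ Λ} φ_X(σ_Λ) + ∑_{X ∩ Λ ≠ ∅, X ∩ Λᶜ ≠ ∅} φ_X(σ_Λ η_{Λᶜ})`, as a function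
of `ω = σ_Λ η_{Λᶜ}`. -/
def energy (φ : Interaction d q) (Λ : Finset (Lattice d)) (ω : Conf d q) : ℝ :=
  ∑ X ∈ Λ.powerset, φ.value X ω +
    ∑' X : {X : Finset (Lattice d) // Straddles X Λ}, φ.value X ω

/-- The expectation of `f` in the Gibbs measure in `Λ` with boundary condition `η`. -/
def gibbsBoundary (β : ℝ) (φ : Interaction d q) (Λ : Finset (Lattice d)) (f : Conf d q → ℂ)
    (η : Conf d q) : ℂ :=
  (∑ σ : Λ → Spin q, f (glue Λ σ η) * Real.exp (-β * φ.energy Λ (glue Λ σ η))) /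
    (∑ σ : Λ → Spin q, Real.exp (-β * φ.energy Λ (glue Λ σ η)) : ℝ)

/-- The σ-algebra `ℱ_{Λᶜ}` generated by the coordinates outside `Λ`. -/
abbrev outsideSigma (d q : ℕ) (Λ : Finset (Lattice d)) : MeasurableSpace (Conf d q) :=
  ⨆ x : {x : Lattice d // x ∉ Λ}, MeasurableSpace.comap (fun σ : Conf d q => σ x) inferInstance

/-- The DLR equations: `E_ν[f | ℱ_{Λᶜ}](η) = μ_Λ^η(f)` for `ν`-almost every `η`, for every finite
`Λ` and `f ∈ C(Ω)`. -/
def SatisfiesDLR (β : ℝ) (φ : Interaction d q) (ν : Measure (Conf d q)) : Prop :=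
  ∀ (Λ : Finset (Lattice d)) (f : C(Conf d q, ℂ)),
    ν[fun σ => f σ | outsideSigma d q Λ] =ᵐ[ν] φ.gibbsBoundary β Λ f

/-! ### Perturbed states and the Gibbs--Araki--Ion condition -/

/-- The trace `∑_{σ_Λ ∈ Ω_Λ} f(σ_Λ, 1)` of `f ∈ C*(𝒢_Λ)`. -/
def trace (Λ : Finset (Lattice d)) (f : CStarG d q) : ℂ :=
  ∑ σ : Λ → Spin q, condE f (glue Λ σ 1)

/-- The finite-volume Gibbs state `μ_{β,φ,Λ}(f) = tr(f e^{-β H_Λ}) / tr(e^{-β H_Λ})` on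
`C*(𝒢_Λ)`. -/
def gibbsFree (β : ℝ) (φ : Interaction d q) (Λ : Finset (Lattice d)) (f : CStarG d q) : ℂ :=
  trace Λ (f * NormedSpace.exp ((-β : ℂ) • φ.hamiltonian Λ)) /
    trace Λ (NormedSpace.exp ((-β : ℂ) • φ.hamiltonian Λ))

end Interaction

/-- The iterated integral `∫_{0 < t_n < ⋯ < t_1 < s} u(t_n) ⋯ u(t_1) dt`, by recursion over the
outermost variable `t_1`. -/
def dysonTerm (u : ℝ → CStarG d q) : ℕ → ℝ → CStarG d q
  | 0, _ => 1
  | n + 1, s => ∫ t in (0 : ℝ)..s, dysonTerm u n t * u t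

/-- `E` is the Araki--Dyson series
`E_{P,is} = ∑_n (-1)^n ∫_{0 < t_n < ⋯ < t_1 < s} τ_{i t_n}(P) ⋯ τ_{i t_1}(P) dt`, where `z ↦ τ_z(P)`
is the analytic continuation `F` of `t ↦ τ_t(P)` to a strip containing the segment `[0, is]`. -/
def IsArakiDyson (τ : ℝ → (CStarG d q →⋆ₐ[ℂ] CStarG d q)) (P : CStarG d q) (s : ℝ)
    (E : CStarG d q) : Prop :=
  ∃ (F : ℂ → CStarG d q) (r : ℝ), |s| < r ∧ DifferentiableOn ℂ F {z | |z.im| < r} ∧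
    (∀ t : ℝ, F t = τ t P) ∧
    HasSum (fun n => (-1 : ℂ) ^ n • dysonTerm (fun t => F (t * Complex.I)) n s) E

/-- The perturbed state `μ^P(f) = μ(E^* f E) / μ(E^* E)`, with `E = E_{P,iβ/2}`. -/
def perturbed (μ : CStarG d q →L[ℂ] ℂ) (E f : CStarG d q) : ℂ :=
  μ (star E * f * E) / μ (star E * E)

/-- The Gibbs--Araki--Ion condition at inverse temperature `β`: `μ` is faithful and, for every
finite `Λ`, the perturbation `μ^P` of `μ` by `P = -W_Λ(φ)`, which removes the surface energy from
the Hamiltonian, is a product state `μ_{β,φ,Λ} ⊗ μ'` for some state `μ'` on `C*(𝒢_{Λᶜ})`. -/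
def GibbsArakiIon (β : ℝ) (φ : Interaction d q) (μ : CStarG d q →L[ℂ] ℂ) : Prop :=
  (∀ a, μ (star a * a) = 0 → a = 0) ∧
  ∃ τ, φ.IsDynamics τ ∧ ∀ Λ : Finset (Lattice d),
    ∃ E, IsArakiDyson τ (-φ.surfaceEnergy Λ) (β / 2) E ∧
      ∃ μ' : localAlg d q ((Λ : Set (Lattice d))ᶜ) →L[ℂ] ℂ, IsState μ' ∧
        ∀ a ∈ localAlg d q (Λ : Set (Lattice d)),
          ∀ b : localAlg d q ((Λ : Set (Lattice d))ᶜ),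
            perturbed μ E (a * b) = φ.gibbsFree β Λ a * μ' b

end Physics

end QSpin

end

/-!
A classical interaction consists of functions on `Ω`, which commute with each other and with all of
`C(Ω)`. This makes both sides of the equivalence explicit.

The generator of the dynamics vanishes on `C(Ω)`, so the dynamics fixes the surface energy `W_Λ`,
the analytic continuation of `t ↦ τ_t(W_Λ)` is constant by the identity theorem, and the Araki-Dyson
series for `P = -W_Λ` sums to `e^{β W_Λ / 2}` (`Interaction.isArakiDyson_iff`). The condition on `μ`
therefore says that `x ↦ μ(e^{β W_Λ / 2} x e^{β W_Λ / 2})` is, up to normalisation, a product of the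
finite-volume Gibbs state in `Λ` and a state outside `Λ`.

Necessity. As `Ω_Λ` is finite, an element of `C_c(𝒢)` that flips only spins in `Λ` is a finite sum
of products of an element of `C*(𝒢_Λ)` and a function of `σ_{Λᶜ}` (`Interaction.ofCc_eq_sum`). The
Gibbs state in `Λ` annihilates the parts with a nontrivial flip, so `μ(f)` is a linear functional of
the boundary condition applied to the Gibbs-weighted sum of `f(·, 1)` over `σ_Λ`
(`Interaction.exists_eq_gibbsSum`). This formula involves only the diagonal of `f`, whence `μ` is
classical, and it yields the DLR equations tested against continuous functions of `σ_{Λᶜ}`; density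
of continuous functions in `L¹` gives the conditional expectation
(`Interaction.satisfiesDLR_of_integral_eq`).

Sufficiency. The dynamics is conjugation by the diagonal unitaries on `ℓ²(𝒢)` whose phases are the
energy differences `H(kσ) - H(σ)`. Only the `φ_X` with `X` meeting the finite support of `k`
contribute to such a difference, so it converges and is continuous in `σ`; it is moreover a cocycle,
so conjugation preserves `C*(𝒢)` and is inner on each `C*(𝒢_Λ)` with `Λ` finite
(`Interaction.isDynamics_dynamics`). A measure satisfying the DLR equations has full support and the
conditional expectation is faithful, so the state is faithful. The product property is the DLR
equation for `e^{β W_Λ} 𝔼(a) 𝔼(b)`, because `𝔼(ab) = 𝔼(a) 𝔼(b)` for `a ∈ C*(𝒢_Λ)` and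
`b ∈ C*(𝒢_{Λᶜ})` (`Interaction.SatisfiesDLR.integral_product`).
-/

set_option linter.unusedSectionVars false

noncomputable section

namespace QSpin

variable {d q : ℕ} [NeZero q]

-- The conditional expectation with its parameters fixed; unification is slow when they are open.
local notation "𝔼" => condE (d := d) (q := q)

/-! ### The embedding of `C(Ω)` and the conditional expectation -/

theorem Flip.finite_supp (g : Flip d q) : g.supp.Finite := g.2

instance : CompleteSpace (CStarG d q) :=
  (StarSubalgebra.isClosed_topologicalClosure _).completeSpace_coe

/-- `C*(𝒢)` is a C*-algebra. This is not an instance because the norm and the ring structure are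
already found through the subalgebra structure. -/
abbrev cstarAlgebra (d q : ℕ) [NeZero q] : CStarAlgebra (CStarG d q) where

theorem rep_unitExt_apply (c : C(Conf d q, ℂ)) (ξ : GHilbert d q) (σ : Conf d q) (k : Flip d q) :
    rep (unitExt c) ξ (σ, k) = c (k • σ) * ξ (σ, k) := by
  classical
  rw [rep_apply_of_subset _ {1} (flips_subset_of _ _ fun σ g hg => by
    rw [unitExt_apply, if_neg (by simpa using hg)])]
  simp [unitExt_apply]

/-- The embedding `C(Ω) → C*(𝒢)` as a homomorphism of star algebras. -/
def ofContHom (d q : ℕ) [NeZero q] : C(Conf d q, ℂ) →⋆ₐ[ℂ] CStarG d q where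
  toFun := ofCont
  map_one' := by
    refine Subtype.ext ?_
    ext ξ ⟨σ, k⟩
    change rep (unitExt 1) ξ (σ, k) = ξ (σ, k)
    simp [rep_unitExt_apply]
  map_mul' f g := by
    refine Subtype.ext ?_
    ext ξ ⟨σ, k⟩
    change rep (unitExt (f * g)) ξ (σ, k) = rep (unitExt f) (rep (unitExt g) ξ) (σ, k)
    simp [rep_unitExt_apply, mul_assoc]
  map_zero' := by
    refine Subtype.ext ?_
    ext ξ ⟨σ, k⟩
    change rep (unitExt 0) ξ (σ, k) = 0
    simp [rep_unitExt_apply]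
  map_add' f g := by
    refine Subtype.ext ?_
    ext ξ ⟨σ, k⟩
    change rep (unitExt (f + g)) ξ (σ, k) = rep (unitExt f) ξ (σ, k) + rep (unitExt g) ξ (σ, k)
    simp [rep_unitExt_apply, add_mul]
  commutes' c := Subtype.ext (rep_unitExt_const c)
  map_star' f := by
    refine Subtype.ext ?_
    change rep (unitExt (star f)) = star (rep (unitExt f))
    rw [← rep_adj]
    congr 1
    ext ⟨σ, g⟩
    rw [adj_apply, unitExt_apply, unitExt_apply]
    by_cases hg : g = 1 <;> simp [hg]

theorem coe_ofContHom : ⇑(ofContHom d q) = ofCont := rfl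

theorem norm_ofCont_le (f : C(Conf d q, ℂ)) : ‖ofCont f‖ ≤ ‖f‖ :=
  let _ := cstarAlgebra d q
  NonUnitalStarAlgHom.norm_apply_le (ofContHom d q) f

theorem continuous_ofCont : Continuous (ofCont : C(Conf d q, ℂ) → CStarG d q) :=
  AddMonoidHomClass.continuous_of_bound (ofContHom d q) 1 fun f => by
    rw [one_mul]
    exact norm_ofCont_le f

theorem ofCont_add (f g : C(Conf d q, ℂ)) : ofCont (f + g) = ofCont f + ofCont g :=
  map_add (ofContHom d q) f g

theorem ofCont_sub (f g : C(Conf d q, ℂ)) : ofCont (f - g) = ofCont f - ofCont g :=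
  map_sub (ofContHom d q) f g

theorem ofCont_mul (f g : C(Conf d q, ℂ)) : ofCont (f * g) = ofCont f * ofCont g :=
  map_mul (ofContHom d q) f g

theorem ofCont_one : ofCont (1 : C(Conf d q, ℂ)) = 1 := map_one (ofContHom d q)

theorem ofCont_smul (c : ℂ) (f : C(Conf d q, ℂ)) : ofCont (c • f) = c • ofCont f :=
  map_smul (ofContHom d q) c f

theorem ofCont_star (f : C(Conf d q, ℂ)) : ofCont (star f) = star (ofCont f) :=
  map_star (ofContHom d q) f

/-- The exponential `σ ↦ e^{f(σ)}` of a continuous function. -/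
def expCont (f : C(Conf d q, ℂ)) : C(Conf d q, ℂ) := ⟨fun σ => Complex.exp (f σ), by fun_prop⟩

theorem expCont_apply (f : C(Conf d q, ℂ)) (σ : Conf d q) : expCont f σ = Complex.exp (f σ) := rfl

theorem exp_eq_expCont (f : C(Conf d q, ℂ)) : NormedSpace.exp f = expCont f := by
  ext σ
  rw [expCont_apply, Complex.exp_eq_exp_ℂ]
  let _ : NormedAlgebra ℚ C(Conf d q, ℂ) := NormedAlgebra.restrictScalars ℚ ℂ _
  exact NormedSpace.map_exp (ContinuousMap.evalAlgHom ℂ ℂ σ)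
    (ContinuousEvalConst.continuous_eval_const σ) f

theorem exp_ofCont (f : C(Conf d q, ℂ)) : NormedSpace.exp (ofCont f) = ofCont (expCont f) := by
  let _ : NormedAlgebra ℚ C(Conf d q, ℂ) := NormedAlgebra.restrictScalars ℚ ℂ _
  let _ : NormedAlgebra ℚ (CStarG d q) := NormedAlgebra.restrictScalars ℚ ℂ _
  rw [← exp_eq_expCont]
  exact (NormedSpace.map_exp (ofContHom d q) continuous_ofCont f).symm

theorem condE_apply (a : CStarG d q) (σ : Conf d q) : 𝔼 a σ = diagEntry a.1 σ := rfl

theorem continuous_condE : Continuous 𝔼 := ContinuousLinearMap.continuous 𝔼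

theorem condE_ofCont (f : C(Conf d q, ℂ)) : 𝔼 (ofCont f) = f := by
  ext σ
  rw [ofCont, condE_ofCc, unitExt_apply, if_pos rfl]

theorem condE_mul_ofCont (a : CStarG d q) (f : C(Conf d q, ℂ)) :
    𝔼 (a * ofCont f) = 𝔼 a * f := by
  classical
  ext σ
  have h : rep (unitExt f) (lp.single 2 (σ, 1) 1 : GHilbert d q) =
      f σ • (lp.single 2 (σ, 1) 1 : GHilbert d q) := by
    ext ⟨σ', k⟩
    rw [rep_unitExt_apply, lp.coeFn_smul, Pi.smul_apply, smul_eq_mul, lp.single_apply]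
    by_cases hp : (σ', k) = (σ, 1)
    · obtain ⟨rfl, rfl⟩ := Prod.mk.inj hp
      simp
    · simp [Pi.single_eq_of_ne hp]
  rw [ContinuousMap.mul_apply, condE_apply, condE_apply, diagEntry, diagEntry]
  change inner ℂ _ (a.1 (rep (unitExt f) _)) = _
  rw [h, map_smul, inner_smul_right, mul_comm]

theorem condE_ofCont_mul (f : C(Conf d q, ℂ)) (a : CStarG d q) :
    𝔼 (ofCont f * a) = f * 𝔼 a := by
  classical
  ext σ
  rw [ContinuousMap.mul_apply, condE_apply, condE_apply, diagEntry, diagEntry]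
  change inner ℂ _ (rep (unitExt f) (a.1 _)) = _
  rw [lp.inner_single_left, lp.inner_single_left, rep_unitExt_apply]
  simp

theorem condE_star (a : CStarG d q) : 𝔼 (star a) = star (𝔼 a) := by
  ext σ
  rw [ContinuousMap.star_apply, condE_apply, condE_apply, diagEntry, diagEntry]
  change inner ℂ _ (star a.1 _) = conj _
  rw [inner_conj_symm, ContinuousLinearMap.star_eq_adjoint,
    ContinuousLinearMap.adjoint_inner_right]

theorem condE_one : 𝔼 (1 : CStarG d q) = 1 := by
  rw [← ofCont_one, condE_ofCont]

theorem ofCc_conv (f g : C_c(Arrow d q, ℂ)) : ofCc (conv f g) = ofCc f * ofCc g :=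
  Subtype.ext (rep_conv f g)

/-- Multiplying by functions on both sides of `f ∈ C_c(𝒢)` multiplies `f(σ, g)` by the values at
the range and at the source of the arrow `(σ, g)`. -/
theorem ofCont_mul_ofCc_mul_ofCont (b c : C(Conf d q, ℂ)) (f f' : C_c(Arrow d q, ℂ))
    (h : ∀ σ g, f' (σ, g) = b (g • σ) * f (σ, g) * c σ) :
    ofCc f' = ofCont b * ofCc f * ofCont c := by
  classical
  refine Subtype.ext ?_
  ext ξ ⟨σ, k⟩
  change rep f' ξ (σ, k) = rep (unitExt b) (rep f (rep (unitExt c) ξ)) (σ, k)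
  have hsub : flips f' ⊆ flips f := flips_subset_of _ _ fun σ g hg => by
    rw [h, apply_eq_zero f hg, mul_zero, zero_mul]
  rw [rep_unitExt_apply, rep_apply_of_subset _ _ hsub, rep_apply_of_subset _ _ subset_rfl,
    Finset.mul_sum]
  refine Finset.sum_congr rfl fun g _ => ?_
  rw [h, rep_unitExt_apply, smul_smul, mul_inv_cancel_left]
  ring

theorem denseRange_ofCc : DenseRange (ofCc : C_c(Arrow d q, ℂ) → CStarG d q) := by
  intro a
  rw [Metric.mem_closure_iff]
  intro ε hε
  obtain ⟨_, ⟨f, -, rfl⟩, hf⟩ := Metric.mem_closure_iff.1 a.2 ε hε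
  exact ⟨ofCc f, ⟨f, rfl⟩, hf⟩

/-- A closed property that holds on `C_c(𝒢_Λ)` holds on `C*(𝒢_Λ)`. -/
theorem localAlg_induction {Λ : Set (Lattice d)} {p : CStarG d q → Prop}
    (hp : IsClosed {a | p a}) (h : ∀ f, IsLocal Λ f → p (ofCc f)) {a : CStarG d q}
    (ha : a ∈ localAlg d q Λ) : p a := by
  have hmem : a ∈ closure {b : CStarG d q | p b} := by
    rw [Metric.mem_closure_iff]
    intro ε hε
    obtain ⟨_, ⟨f, hloc, rfl⟩, hf⟩ := Metric.mem_closure_iff.1 ha ε hε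
    exact ⟨ofCc f, h f hloc, hf⟩
  rwa [hp.closure_eq] at hmem

theorem ofCc_mem_localAlg {Λ : Set (Lattice d)} {f : C_c(Arrow d q, ℂ)} (hf : IsLocal Λ f) :
    ofCc f ∈ localAlg d q Λ :=
  StarSubalgebra.le_topologicalClosure (repAlg d q Λ) ⟨f, hf, rfl⟩

theorem isLocal_unitExt {Λ : Set (Lattice d)} {c : C(Conf d q, ℂ)}
    (hc : ∀ σ σ' : Conf d q, (∀ x ∈ Λ, σ x = σ' x) → c σ = c σ') : IsLocal Λ (unitExt c) := by
  refine ⟨fun σ g hg => ?_, fun σ σ' g h => ?_⟩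
  · rw [unitExt_apply, if_neg]
    rintro rfl
    exact hg fun x hx => absurd (Flip.one_val x) hx
  · rw [unitExt_apply, unitExt_apply, hc σ σ' h]

theorem ofCont_mem_localAlg {Λ : Set (Lattice d)} {c : C(Conf d q, ℂ)}
    (hc : ∀ σ σ' : Conf d q, (∀ x ∈ Λ, σ x = σ' x) → c σ = c σ') :
    ofCont c ∈ localAlg d q Λ :=
  ofCc_mem_localAlg (isLocal_unitExt hc)

/-! ### Classical interactions as continuous functions -/

theorem norm_condE_le (a : CStarG d q) : ‖𝔼 a‖ ≤ ‖a‖ :=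
  (ContinuousMap.norm_le _ (norm_nonneg _)).2 fun σ => norm_diagEntry_le a.1 σ

namespace Interaction

variable {φ : Interaction d q}

/-- The sets `X` meeting a finite `Λ` are covered by the families `{X : x ∈ X}`, `x ∈ Λ`. -/
theorem IsSummable.summable_meeting (hφ : φ.IsSummable) (Λ : Finset (Lattice d)) :
    Summable fun X : {X : Finset (Lattice d) // ∃ x ∈ X, x ∈ Λ} => ‖φ.toFun X‖ := by
  have h1 : ∀ x : Lattice d, Summable
      ({X : Finset (Lattice d) | x ∈ X}.indicator fun X => ‖φ.toFun X‖) := fun x =>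
    summable_subtype_iff_indicator.1 (hφ x)
  refine (summable_subtype_iff_indicator (f := fun X => ‖φ.toFun X‖)
    (s := {X : Finset (Lattice d) | ∃ x ∈ X, x ∈ Λ})).2 ?_
  refine (summable_sum (s := Λ) fun x _ => h1 x).of_nonneg_of_le
    (fun X => Set.indicator_nonneg (fun _ _ => norm_nonneg _) _) fun X => ?_
  by_cases hX : ∃ x ∈ X, x ∈ Λ
  · obtain ⟨x, hxX, hxΛ⟩ := hX
    have h2 := Finset.single_le_sum (s := Λ)
      (f := fun x => {X : Finset (Lattice d) | x ∈ X}.indicator (fun X => ‖φ.toFun X‖) X)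
      (fun _ _ => Set.indicator_nonneg (fun _ _ => norm_nonneg _) _) hxΛ
    refine le_trans ?_ h2
    rw [Set.indicator_of_mem (show X ∈ {X : Finset (Lattice d) | x ∈ X} from hxX)]
    exact Set.indicator_le_self' (fun _ _ => norm_nonneg _) _
  · rw [Set.indicator_of_notMem (by exact hX)]
    exact Finset.sum_nonneg fun _ _ => Set.indicator_nonneg (fun _ _ => norm_nonneg _) _

theorem IsSummable.summable_straddling (hφ : φ.IsSummable) (Λ : Finset (Lattice d)) :
    Summable fun X : {X : Finset (Lattice d) // Straddles X Λ} => ‖φ.toFun X‖ :=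
  Summable.comp_injective
    (f := fun X : {X : Finset (Lattice d) // ∃ x ∈ X, x ∈ Λ} => ‖φ.toFun X.1‖)
    (i := fun X : {X : Finset (Lattice d) // Straddles X Λ} => ⟨X.1, X.2.1⟩)
    (hφ.summable_meeting Λ) fun _ _ h => Subtype.ext (Subtype.mk.inj h)

theorem IsSummable.summable_condE_meeting (hφ : φ.IsSummable) (Λ : Finset (Lattice d)) :
    Summable fun X : {X : Finset (Lattice d) // ∃ x ∈ X, x ∈ Λ} => 𝔼 (φ.toFun X) :=
  Summable.of_norm_bounded (hφ.summable_meeting Λ) fun X => norm_condE_le (φ.toFun X.1)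

theorem IsSummable.summable_condE_straddling (hφ : φ.IsSummable) (Λ : Finset (Lattice d)) :
    Summable fun X : {X : Finset (Lattice d) // Straddles X Λ} => 𝔼 (φ.toFun X) :=
  Summable.of_norm_bounded (hφ.summable_straddling Λ) fun X => norm_condE_le (φ.toFun X.1)

theorem IsClassical.ofCont_condE (hcl : φ.IsClassical) (X : Finset (Lattice d)) :
    ofCont (𝔼 (φ.toFun X)) = φ.toFun X := by
  obtain ⟨f, -, hf⟩ := hcl X
  rw [hf, condE_ofCont]

theorem IsClassical.condE_congr (hcl : φ.IsClassical) {X : Finset (Lattice d)} {σ σ' : Conf d q}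
    (h : ∀ x ∈ X, σ x = σ' x) : 𝔼 (φ.toFun X) σ = 𝔼 (φ.toFun X) σ' := by
  obtain ⟨f, hloc, hf⟩ := hcl X
  rw [hf, condE_ofCont, hloc σ σ' h]

theorem ofReal_value (X : Finset (Lattice d)) (σ : Conf d q) :
    (φ.value X σ : ℂ) = 𝔼 (φ.toFun X) σ := by
  refine Complex.conj_eq_iff_re.1 ?_
  have h := condE_star (φ.toFun X)
  rw [(φ.selfAdj X).star_eq] at h
  exact (DFunLike.congr_fun h σ).symm

variable (φ) in
/-- The function on `Ω` representing `H_Λ`. -/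
def bulkFun (Λ : Finset (Lattice d)) : C(Conf d q, ℂ) :=
  ∑ X ∈ Λ.powerset, 𝔼 (φ.toFun X)

variable (φ) in
/-- The function on `Ω` representing `W_Λ`. -/
def surfaceFun (Λ : Finset (Lattice d)) : C(Conf d q, ℂ) :=
  ∑' X : {X : Finset (Lattice d) // Straddles X Λ}, 𝔼 (φ.toFun X)

variable (φ) in
/-- The function on `Ω` representing the sum of all `φ_X` with `X` meeting `Λ`. -/
def meetingFun (Λ : Finset (Lattice d)) : C(Conf d q, ℂ) :=
  ∑' X : {X : Finset (Lattice d) // ∃ x ∈ X, x ∈ Λ}, 𝔼 (φ.toFun X)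

theorem IsClassical.hamiltonian_eq (hcl : φ.IsClassical) (Λ : Finset (Lattice d)) :
    φ.hamiltonian Λ = ofCont (φ.bulkFun Λ) := by
  rw [hamiltonian, bulkFun, ← coe_ofContHom, map_sum]
  exact Finset.sum_congr rfl fun X _ => (hcl.ofCont_condE X).symm

theorem surfaceEnergy_eq (hφ : φ.IsSummable) (hcl : φ.IsClassical) (Λ : Finset (Lattice d)) :
    φ.surfaceEnergy Λ = ofCont (φ.surfaceFun Λ) := by
  rw [surfaceEnergy, surfaceFun, ← coe_ofContHom,
    (hφ.summable_condE_straddling Λ).map_tsum (ofContHom d q) continuous_ofCont]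
  exact tsum_congr fun X => (hcl.ofCont_condE X).symm

theorem IsClassical.bulkFun_congr (hcl : φ.IsClassical) {Λ : Finset (Lattice d)}
    {σ σ' : Conf d q} (h : ∀ x ∈ Λ, σ x = σ' x) : φ.bulkFun Λ σ = φ.bulkFun Λ σ' := by
  rw [bulkFun, ContinuousMap.sum_apply, ContinuousMap.sum_apply]
  exact Finset.sum_congr rfl fun X hX =>
    hcl.condE_congr fun x hx => h x (Finset.mem_powerset.1 hX hx)

theorem meetingFun_apply (hφ : φ.IsSummable) (Λ : Finset (Lattice d)) (σ : Conf d q) :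
    φ.meetingFun Λ σ =
      ((∑' X : {X : Finset (Lattice d) // ∃ x ∈ X, x ∈ Λ}, φ.value X σ : ℝ) : ℂ) := by
  rw [meetingFun, ← ContinuousMap.tsum_apply (hφ.summable_condE_meeting Λ), Complex.ofReal_tsum]
  exact tsum_congr fun X => (ofReal_value _ _).symm

theorem surfaceFun_apply (hφ : φ.IsSummable) (Λ : Finset (Lattice d)) (σ : Conf d q) :
    φ.surfaceFun Λ σ =
      ((∑' X : {X : Finset (Lattice d) // Straddles X Λ}, φ.value X σ : ℝ) : ℂ) := by
  rw [surfaceFun, ← ContinuousMap.tsum_apply (hφ.summable_condE_straddling Λ),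
    Complex.ofReal_tsum]
  exact tsum_congr fun X => (ofReal_value _ _).symm

theorem ofReal_energy (hφ : φ.IsSummable) (Λ : Finset (Lattice d)) (σ : Conf d q) :
    (φ.energy Λ σ : ℂ) = φ.bulkFun Λ σ + φ.surfaceFun Λ σ := by
  rw [energy, surfaceFun_apply hφ, bulkFun, ContinuousMap.sum_apply]
  push_cast
  simp_rw [ofReal_value]

/-! ### Gibbs weights -/

theorem glue_of_mem {Λ : Finset (Lattice d)} (s : Λ → Spin q) (η : Conf d q) {x : Lattice d}
    (hx : x ∈ Λ) : glue Λ s η x = s ⟨x, hx⟩ := dif_pos hx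

theorem glue_of_notMem {Λ : Finset (Lattice d)} (s : Λ → Spin q) (η : Conf d q) {x : Lattice d}
    (hx : x ∉ Λ) : glue Λ s η x = η x := dif_neg hx

theorem continuous_glue (Λ : Finset (Lattice d)) (s : Λ → Spin q) :
    Continuous (glue Λ s : Conf d q → Conf d q) := by
  refine continuous_pi fun x => ?_
  by_cases hx : x ∈ Λ
  · simpa only [glue_of_mem s _ hx] using continuous_const
  · simpa only [glue_of_notMem s _ hx] using continuous_apply x

theorem glue_congr {Λ : Finset (Lattice d)} (s : Λ → Spin q) {η η' : Conf d q}
    (h : ∀ x ∉ Λ, η x = η' x) : glue Λ s η = glue Λ s η' := by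
  funext x
  by_cases hx : x ∈ Λ
  · rw [glue_of_mem s _ hx, glue_of_mem s _ hx]
  · rw [glue_of_notMem s _ hx, glue_of_notMem s _ hx, h x hx]

theorem glue_restrict (Λ : Finset (Lattice d)) (σ : Conf d q) :
    glue Λ (fun x => σ x) σ = σ := by
  funext x
  by_cases hx : x ∈ Λ
  · rw [glue_of_mem _ _ hx]
  · rw [glue_of_notMem _ _ hx]

/-- The weighted sum `η ↦ ∑_{σ_Λ} f(σ_Λ η_{Λᶜ}) e^{-β (H_Λ + W_Λ)(σ_Λ η_{Λᶜ})}`. -/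
def gibbsSum (β : ℝ) (φ : Interaction d q) (Λ : Finset (Lattice d)) (f : C(Conf d q, ℂ)) :
    C(Conf d q, ℂ) where
  toFun η := ∑ s : Λ → Spin q, f (glue Λ s η) *
    Complex.exp (-β * (φ.bulkFun Λ (glue Λ s η) + φ.surfaceFun Λ (glue Λ s η)))
  continuous_toFun := by
    refine continuous_finsetSum _ fun s _ => ?_
    have := continuous_glue (q := q) Λ s
    fun_prop

theorem gibbsSum_apply (β : ℝ) (φ : Interaction d q) (Λ : Finset (Lattice d))
    (f : C(Conf d q, ℂ)) (η : Conf d q) :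
    gibbsSum β φ Λ f η = ∑ s : Λ → Spin q, f (glue Λ s η) *
      Complex.exp (-β * (φ.bulkFun Λ (glue Λ s η) + φ.surfaceFun Λ (glue Λ s η))) := rfl

theorem ofReal_exp_energy (hφ : φ.IsSummable) (β : ℝ) (Λ : Finset (Lattice d)) (σ : Conf d q) :
    (Real.exp (-β * φ.energy Λ σ) : ℂ) =
      Complex.exp (-β * (φ.bulkFun Λ σ + φ.surfaceFun Λ σ)) := by
  rw [← ofReal_energy hφ]
  push_cast
  rfl

theorem gibbsSum_one_apply (hφ : φ.IsSummable) (β : ℝ) (Λ : Finset (Lattice d)) (η : Conf d q) :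
    gibbsSum β φ Λ 1 η =
      ((∑ s : Λ → Spin q, Real.exp (-β * φ.energy Λ (glue Λ s η)) : ℝ) : ℂ) := by
  rw [gibbsSum_apply, Complex.ofReal_sum]
  refine Finset.sum_congr rfl fun s _ => ?_
  rw [ofReal_exp_energy hφ, ContinuousMap.one_apply, one_mul]

theorem sum_exp_energy_pos (β : ℝ) (φ : Interaction d q) (Λ : Finset (Lattice d))
    (η : Conf d q) : 0 < ∑ s : Λ → Spin q, Real.exp (-β * φ.energy Λ (glue Λ s η)) :=
  Finset.sum_pos (fun _ _ => Real.exp_pos _) Finset.univ_nonempty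

theorem gibbsSum_one_ne_zero (hφ : φ.IsSummable) (β : ℝ) (Λ : Finset (Lattice d))
    (η : Conf d q) : gibbsSum β φ Λ 1 η ≠ 0 := by
  rw [gibbsSum_one_apply hφ, Complex.ofReal_ne_zero]
  exact (sum_exp_energy_pos β φ Λ η).ne'

theorem gibbsSum_congr (β : ℝ) (φ : Interaction d q) (Λ : Finset (Lattice d))
    (f : C(Conf d q, ℂ)) {η η' : Conf d q} (h : ∀ x ∉ Λ, η x = η' x) :
    gibbsSum β φ Λ f η = gibbsSum β φ Λ f η' := by
  simp only [gibbsSum_apply, glue_congr _ h]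

theorem gibbsBoundary_eq (hφ : φ.IsSummable) (β : ℝ) (Λ : Finset (Lattice d))
    (f : C(Conf d q, ℂ)) (η : Conf d q) :
    φ.gibbsBoundary β Λ f η = gibbsSum β φ Λ f η / gibbsSum β φ Λ 1 η := by
  rw [gibbsBoundary, gibbsSum_one_apply hφ, gibbsSum_apply]
  simp only [ofReal_exp_energy hφ]

theorem continuous_gibbsBoundary (hφ : φ.IsSummable) (β : ℝ) (Λ : Finset (Lattice d))
    (f : C(Conf d q, ℂ)) : Continuous (φ.gibbsBoundary β Λ f) := by
  rw [funext (gibbsBoundary_eq hφ β Λ f)]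
  exact (map_continuous _).div (map_continuous _) (gibbsSum_one_ne_zero hφ β Λ)

theorem IsClassical.exp_hamiltonian (hcl : φ.IsClassical) (β : ℝ) (Λ : Finset (Lattice d)) :
    NormedSpace.exp ((-β : ℂ) • φ.hamiltonian Λ) = ofCont (expCont ((-β : ℂ) • φ.bulkFun Λ)) := by
  rw [hcl.hamiltonian_eq, ← ofCont_smul, exp_ofCont]

theorem IsClassical.trace_mul_exp (hcl : φ.IsClassical) (β : ℝ) (Λ : Finset (Lattice d))
    (a : CStarG d q) :
    trace Λ (a * NormedSpace.exp ((-β : ℂ) • φ.hamiltonian Λ)) =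
      ∑ s : Λ → Spin q, 𝔼 a (glue Λ s 1) * Complex.exp (-β * φ.bulkFun Λ (glue Λ s 1)) := by
  rw [trace, hcl.exp_hamiltonian, condE_mul_ofCont]
  rfl

theorem IsClassical.trace_exp (hcl : φ.IsClassical) (β : ℝ) (Λ : Finset (Lattice d)) :
    trace Λ (NormedSpace.exp ((-β : ℂ) • φ.hamiltonian Λ)) =
      ((∑ s : Λ → Spin q,
        Real.exp (-β * ∑ X ∈ Λ.powerset, φ.value X (glue Λ s 1)) : ℝ) : ℂ) := by
  have h := hcl.trace_mul_exp β Λ 1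
  rw [one_mul] at h
  rw [h, Complex.ofReal_sum]
  refine Finset.sum_congr rfl fun s _ => ?_
  rw [condE_one, ContinuousMap.one_apply, one_mul, bulkFun, ContinuousMap.sum_apply]
  push_cast
  simp_rw [ofReal_value]

theorem IsClassical.trace_exp_ne_zero (hcl : φ.IsClassical) (β : ℝ) (Λ : Finset (Lattice d)) :
    trace Λ (NormedSpace.exp ((-β : ℂ) • φ.hamiltonian Λ)) ≠ 0 := by
  rw [hcl.trace_exp, Complex.ofReal_ne_zero]
  exact (Finset.sum_pos (fun _ _ => Real.exp_pos _) Finset.univ_nonempty).ne'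

end Interaction

/-! ### The Araki-Dyson series of an invariant perturbation -/

theorem dysonTerm_of_eqOn {u : ℝ → CStarG d q} {P : CStarG d q} {S : ℝ}
    (hu : ∀ t ∈ Set.Icc 0 S, u t = P) (n : ℕ) :
    ∀ s ∈ Set.Icc 0 S, dysonTerm u n s = ((s ^ n / n.factorial : ℝ) : ℂ) • P ^ n := by
  induction n with
  | zero =>
    intro s _
    simp [dysonTerm]
  | succ n ih =>
    intro s hs
    have h1 : ∀ t ∈ Set.uIcc 0 s, dysonTerm u n t * u t =
        ((t ^ n / n.factorial : ℝ) : ℂ) • P ^ (n + 1) := by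
      intro t ht
      rw [Set.uIcc_of_le hs.1] at ht
      have ht' : t ∈ Set.Icc 0 S := ⟨ht.1, ht.2.trans hs.2⟩
      rw [ih t ht', hu t ht', smul_mul_assoc, pow_succ]
    rw [dysonTerm, intervalIntegral.integral_congr h1, intervalIntegral.integral_smul_const,
      intervalIntegral.integral_ofReal, intervalIntegral.integral_div, integral_pow]
    congr 2
    rw [Nat.factorial_succ]
    push_cast
    field_simp
    simp

theorem hasSum_dysonTerm {u : ℝ → CStarG d q} {P : CStarG d q} {s : ℝ} (hs : 0 ≤ s)
    (hu : ∀ t ∈ Set.Icc 0 s, u t = P) :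
    HasSum (fun n => (-1 : ℂ) ^ n • dysonTerm u n s) (NormedSpace.exp ((-s : ℂ) • P)) := by
  have h := NormedSpace.exp_series_hasSum_exp' (𝕂 := ℂ) ((-s : ℂ) • P)
  have heq : (fun n => (-1 : ℂ) ^ n • dysonTerm u n s) =
      fun n => (n.factorial⁻¹ : ℂ) • ((-s : ℂ) • P) ^ n := by
    funext n
    rw [dysonTerm_of_eqOn hu n s ⟨hs, le_rfl⟩, smul_smul, smul_pow, smul_smul]
    congr 1
    push_cast
    rw [neg_pow (s : ℂ)]
    ring
  rw [heq]
  exact h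

/-- If `P` is invariant under the dynamics, the analytic continuation of `t ↦ τ_t(P)` is constant
and the Araki-Dyson series is the exponential series of `-s P`. -/
theorem isArakiDyson_iff_of_invariant {τ : ℝ → (CStarG d q →⋆ₐ[ℂ] CStarG d q)} {P : CStarG d q}
    (hP : ∀ t, τ t P = P) {s : ℝ} (hs : 0 ≤ s) (E : CStarG d q) :
    IsArakiDyson τ P s E ↔ E = NormedSpace.exp ((-s : ℂ) • P) := by
  constructor
  · rintro ⟨F, r, hr, hF, hFτ, hsum⟩
    rw [abs_of_nonneg hs] at hr
    have hopen : IsOpen {z : ℂ | |z.im| < r} :=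
      isOpen_lt (by fun_prop) continuous_const
    have hconv : Convex ℝ {z : ℂ | |z.im| < r} := by
      have hset : {z : ℂ | |z.im| < r} = Complex.imLm ⁻¹' Metric.ball 0 r := by
        ext z
        simp
      rw [hset]
      exact (convex_ball (0 : ℝ) r).linear_preimage Complex.imLm
    have heq : Set.EqOn F (fun _ => P) {z : ℂ | |z.im| < r} := by
      refine (hF.analyticOnNhd hopen).eqOn_of_preconnected_of_frequently_eq
        analyticOnNhd_const hconv.isPreconnected (z₀ := 0) (by simpa using hs.trans_lt hr) ?_
      have ht : Tendsto (fun t : ℝ => (t : ℂ)) (𝓝[≠] 0) (𝓝[≠] 0) := by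
        refine tendsto_nhdsWithin_iff.2 ⟨?_, ?_⟩
        · exact (Complex.continuous_ofReal.tendsto' 0 0 Complex.ofReal_zero).mono_left
            nhdsWithin_le_nhds
        · filter_upwards [self_mem_nhdsWithin] with t ht
          simpa using ht
      exact ht.frequently (Eventually.of_forall fun t => (hFτ t).trans (hP t)).frequently
    refine hsum.unique (hasSum_dysonTerm hs fun t ht => heq ?_)
    simpa [abs_of_nonneg ht.1] using ht.2.trans_lt hr
  · rintro rfl
    exact ⟨fun _ => P, |s| + 1, by linarith, by fun_prop, fun t => (hP t).symm,
      hasSum_dysonTerm hs fun _ _ => rfl⟩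

/-! ### Measures on the configuration space -/

instance : MeasurableSingletonClass (Spin q) where
  measurableSet_singleton a :=
    ⟨{(a : ℂˣ)}, ⟨{((a : ℂˣ) : ℂ)}, measurableSet_singleton _,
      Set.ext fun _ => Units.ext_iff.symm⟩, Set.ext fun _ => Subtype.ext_iff.symm⟩

/-- A positive functional on `C(Ω)` is integration against its Riesz-Markov measure. -/
theorem IsState.exists_isRieszMarkov {μ : CStarG d q →L[ℂ] ℂ} (hμ : IsState μ) :
    ∃ ν, IsRieszMarkov μ ν := by
  let toC : C_c(Conf d q, ℝ) → C(Conf d q, ℂ) := fun f => ⟨fun σ => (f σ : ℂ), by fun_prop⟩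
  have htoC_add : ∀ f g, toC (f + g) = toC f + toC g := fun f g => by
    ext σ
    simp [toC]
  have htoC_smul : ∀ (c : ℝ) f, toC (c • f) = (c : ℂ) • toC f := fun c f => by
    ext σ
    simp [toC]
  -- A nonnegative function is the square of its square root.
  have hpos : ∀ f : C_c(Conf d q, ℝ), 0 ≤ f → 0 ≤ μ (ofCont (toC f)) := fun f hf => by
    let g : C(Conf d q, ℂ) := ⟨fun σ => (Real.sqrt (f σ) : ℂ), by fun_prop⟩
    have hg : toC f = star g * g := by
      ext σ
      have h := Real.mul_self_sqrt (hf σ)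
      simp only [toC, g, ContinuousMap.coe_mk, ContinuousMap.mul_apply, ContinuousMap.star_apply,
        RCLike.star_def, Complex.conj_ofReal]
      rw [← Complex.ofReal_mul, h]
    rw [hg, ofCont_mul, ofCont_star]
    exact hμ.pos _
  let L : C_c(Conf d q, ℝ) →ₚ[ℝ] ℝ := PositiveLinearMap.mk₀
    { toFun := fun f => (μ (ofCont (toC f))).re
      map_add' := fun f g => by rw [htoC_add, ofCont_add, map_add, Complex.add_re]
      map_smul' := fun c f => by
        rw [htoC_smul, ofCont_smul, map_smul, smul_eq_mul, Complex.re_ofReal_mul]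
        rfl }
    fun f hf => (Complex.le_def.1 (hpos f hf)).1
  let cc : C(Conf d q, ℝ) → C_c(Conf d q, ℝ) := fun f =>
    CompactlySupportedContinuousMap.continuousMapEquiv f
  have hL : ∀ f : C(Conf d q, ℝ), (L (cc f) : ℂ) = μ (ofCont (toC (cc f))) := fun f => by
    have him : ∀ f : C_c(Conf d q, ℝ), 0 ≤ f → (μ (ofCont (toC f))).im = 0 := fun f hf =>
      (Complex.le_def.1 (hpos f hf)).2.symm
    -- Every real function is a difference of nonnegative ones.
    have hdec : cc f = cc (f + ContinuousMap.const _ ‖f‖) - cc (ContinuousMap.const _ ‖f‖) := by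
      ext σ
      simp [cc]
    have h1 : (0 : C_c(Conf d q, ℝ)) ≤ cc (f + ContinuousMap.const _ ‖f‖) := fun σ => by
      have := (abs_le.1 (f.norm_coe_le_norm σ)).1
      change 0 ≤ f σ + ‖f‖
      linarith
    have h2 : (0 : C_c(Conf d q, ℝ)) ≤ cc (ContinuousMap.const _ ‖f‖) := fun σ => norm_nonneg f
    refine Complex.ext rfl ?_
    rw [Complex.ofReal_im]
    have h3 : toC (cc f) =
        toC (cc (f + ContinuousMap.const _ ‖f‖)) - toC (cc (ContinuousMap.const _ ‖f‖)) := by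
      ext σ
      simp [toC, cc]
    rw [h3, ofCont_sub, map_sub, Complex.sub_im, him _ h1, him _ h2, sub_zero]
  have hint : ∀ f : C(Conf d q, ℝ),
      ((∫ σ, f σ ∂(RealRMK.rieszMeasure L) : ℝ) : ℂ) = μ (ofCont (toC (cc f))) := fun f => by
    rw [← hL f, ← RealRMK.integral_rieszMeasure L (cc f)]
    rfl
  have hfin : IsFiniteMeasureOnCompacts (RealRMK.rieszMeasure L) := inferInstance
  have : IsFiniteMeasure (RealRMK.rieszMeasure L) := inferInstance
  refine ⟨RealRMK.rieszMeasure L, ⟨?_⟩, fun f => ?_⟩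
  · have h := hint 1
    have h1 : toC (cc 1) = 1 := by
      ext σ
      simp [toC, cc]
    rw [h1, ofCont_one, hμ.map_one] at h
    simp only [ContinuousMap.one_apply, integral_const, smul_eq_mul, mul_one,
      Complex.ofReal_eq_one, Measure.real] at h
    rwa [ENNReal.toReal_eq_one_iff] at h
  · have hfi : Integrable f (RealRMK.rieszMeasure L) :=
      (map_continuous f).integrable_of_hasCompactSupport (HasCompactSupport.of_compactSpace _)
    let fr : C(Conf d q, ℝ) := ⟨fun σ => (f σ).re, by fun_prop⟩
    let fi : C(Conf d q, ℝ) := ⟨fun σ => (f σ).im, by fun_prop⟩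
    have hf : f = toC (cc fr) + Complex.I • toC (cc fi) := by
      ext σ
      change f σ = ((f σ).re : ℂ) + Complex.I * ((f σ).im : ℂ)
      rw [mul_comm, Complex.re_add_im]
    rw [← integral_re_add_im hfi]
    conv_rhs => rw [hf, ofCont_add, ofCont_smul, map_add, map_smul, ← hint fr, ← hint fi]
    rw [smul_eq_mul, mul_comm Complex.I]
    rfl

namespace Interaction

theorem measurable_glue_outside (Λ : Finset (Lattice d)) (s : Λ → Spin q) :
    Measurable[outsideSigma d q Λ, MeasurableSpace.pi] (glue Λ s : Conf d q → Conf d q) := by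
  refine @measurable_pi_lambda _ _ _ (outsideSigma d q Λ) _ _ fun x => ?_
  by_cases hx : x ∈ Λ
  · simp only [glue_of_mem s _ hx]
    exact measurable_const
  · simp only [glue_of_notMem s _ hx]
    exact Measurable.of_comap_le
      (le_iSup (fun x : {x : Lattice d // x ∉ Λ} =>
        MeasurableSpace.comap (fun σ : Conf d q => σ x) inferInstance) ⟨x, hx⟩)

theorem outsideSigma_le (Λ : Finset (Lattice d)) :
    outsideSigma d q Λ ≤ MeasurableSpace.pi :=
  iSup_le fun x => (measurable_pi_apply x.1).comap_le

/-- Events outside `Λ` are preimages under freezing the configuration inside `Λ`. -/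
theorem exists_preimage_glue_of_measurableSet (Λ : Finset (Lattice d)) (s : Λ → Spin q)
    {A : Set (Conf d q)} (hA : MeasurableSet[outsideSigma d q Λ] A) :
    ∃ B : Set (Conf d q), MeasurableSet B ∧ glue Λ s ⁻¹' B = A := by
  have hle : outsideSigma d q Λ ≤ MeasurableSpace.comap (glue Λ s) MeasurableSpace.pi := by
    refine iSup_le fun x => ?_
    have h : (fun σ : Conf d q => σ x) = (fun σ => σ x) ∘ glue Λ s := by
      funext σ
      exact (glue_of_notMem s σ x.2).symm
    rw [h, ← MeasurableSpace.comap_comp]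
    exact MeasurableSpace.comap_mono (measurable_pi_apply x.1).comap_le
  exact hle A hA

variable {φ : Interaction d q}

theorem integrable_of_continuous (ν : Measure (Conf d q)) [IsFiniteMeasure ν]
    {f : Conf d q → ℂ} (hf : Continuous f) : Integrable f ν :=
  hf.integrable_of_hasCompactSupport (HasCompactSupport.of_compactSpace _)

/-- The DLR equations follow from their tested form against continuous functions of `σ_{Λᶜ}`,
because continuous functions are dense in `L¹`. -/
theorem satisfiesDLR_of_integral_eq (hφ : φ.IsSummable) {β : ℝ} (ν : Measure (Conf d q))
    [IsProbabilityMeasure ν]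
    (h : ∀ (Λ : Finset (Lattice d)) (f g : C(Conf d q, ℂ)),
      (∀ σ σ' : Conf d q, (∀ x ∉ Λ, σ x = σ' x) → g σ = g σ') →
        ∫ σ, g σ * φ.gibbsBoundary β Λ f σ ∂ν = ∫ σ, g σ * f σ ∂ν) :
    φ.SatisfiesDLR β ν := by
  intro Λ f
  have hcont := continuous_gibbsBoundary hφ β Λ f
  have hgi : Integrable (φ.gibbsBoundary β Λ f) ν := integrable_of_continuous ν hcont
  have hfi : Integrable (fun σ => f σ) ν := integrable_of_continuous ν (map_continuous f)
  let T : Conf d q → Conf d q := glue Λ 1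
  have hTc : Continuous T := continuous_glue Λ 1
  refine (ae_eq_condExp_of_forall_setIntegral_eq (outsideSigma_le Λ) hfi
    (fun _ _ _ => hgi.integrableOn) (fun A hA _ => ?_) ?_).symm
  · obtain ⟨B, hB, rfl⟩ := exists_preimage_glue_of_measurableSet Λ 1 hA
    have hA' : MeasurableSet (T ⁻¹' B) := hTc.measurable hB
    let D : C(Conf d q, ℂ) := ⟨fun σ => φ.gibbsBoundary β Λ f σ - f σ, by fun_prop⟩
    have hDi : Integrable D ν := integrable_of_continuous ν (map_continuous D)
    rw [← sub_eq_zero, ← integral_sub hgi.integrableOn hfi.integrableOn]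
    change ∫ σ in T ⁻¹' B, D σ ∂ν = 0
    rw [← norm_eq_zero]
    refine le_antisymm (le_of_forall_pos_le_add fun ε hε => ?_) (norm_nonneg _)
    have hδ : 0 < ε / (‖D‖ + 1) := by positivity
    have hBi : Integrable (B.indicator fun _ => (1 : ℂ)) (ν.map T) :=
      (integrable_const _).indicator hB
    have hreg : (ν.map T).WeaklyRegular := by
      let _ := TopologicalSpace.pseudoMetrizableSpacePseudoMetric (Conf d q)
      infer_instance
    obtain ⟨g, hg, hgint⟩ := hBi.exists_boundedContinuous_integral_sub_le hδ
    let g' : C(Conf d q, ℂ) := ⟨fun σ => g (T σ), by fun_prop⟩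
    have hg0 : ∫ σ, g' σ * D σ ∂ν = 0 := by
      have h1 := h Λ f g' fun σ σ' hσ => by
        change g (glue Λ 1 σ) = g (glue Λ 1 σ')
        rw [glue_congr 1 hσ]
      have h2 : ∀ σ, g' σ * D σ = g' σ * φ.gibbsBoundary β Λ f σ - g' σ * f σ := fun σ =>
        mul_sub _ _ _
      simp_rw [h2]
      rw [integral_sub (integrable_of_continuous ν (by fun_prop))
        (integrable_of_continuous ν (by fun_prop)), h1, sub_self]
    have hind : ∀ σ, (T ⁻¹' B).indicator D σ = B.indicator (fun _ => (1 : ℂ)) (T σ) * D σ := by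
      intro σ
      by_cases hσ : T σ ∈ B
      · rw [Set.indicator_of_mem (by exact hσ), Set.indicator_of_mem hσ, one_mul]
      · rw [Set.indicator_of_notMem (by exact hσ), Set.indicator_of_notMem hσ, zero_mul]
    have hg'i : Integrable (fun σ => g' σ * D σ) ν := integrable_of_continuous ν (by fun_prop)
    have hdiff : Integrable (fun x => ‖B.indicator (fun _ => (1 : ℂ)) x - g x‖) (ν.map T) :=
      (hBi.sub hgint).norm
    calc ‖∫ σ in T ⁻¹' B, D σ ∂ν‖
        = ‖∫ σ, ((T ⁻¹' B).indicator D σ - g' σ * D σ) ∂ν‖ := by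
          rw [integral_sub (hDi.indicator hA') hg'i, hg0, sub_zero, integral_indicator hA']
      _ ≤ ∫ σ, ‖B.indicator (fun _ => (1 : ℂ)) (T σ) - g (T σ)‖ * ‖D‖ ∂ν := by
          refine norm_integral_le_of_norm_le ?_ (Eventually.of_forall fun σ => ?_)
          · exact (hdiff.comp_measurable hTc.measurable).mul_const _
          · rw [hind]
            change ‖_ - g (T σ) * D σ‖ ≤ _
            rw [← sub_mul, norm_mul]
            exact mul_le_mul_of_nonneg_left (D.norm_coe_le_norm σ) (norm_nonneg _)
      _ = (∫ x, ‖B.indicator (fun _ => (1 : ℂ)) x - g x‖ ∂(ν.map T)) * ‖D‖ := by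
          rw [integral_mul_const, integral_map hTc.aemeasurable hdiff.aestronglyMeasurable]
      _ ≤ ε / (‖D‖ + 1) * ‖D‖ := mul_le_mul_of_nonneg_right hg (norm_nonneg _)
      _ ≤ 0 + ε := by
          rw [zero_add, div_mul_eq_mul_div, div_le_iff₀ (by positivity)]
          nlinarith [norm_nonneg D]
  · have h1 : φ.gibbsBoundary β Λ f = φ.gibbsBoundary β Λ f ∘ T := by
      funext σ
      have hT : ∀ x ∉ Λ, σ x = T σ x := fun x hx => (glue_of_notMem 1 σ hx).symm
      rw [Function.comp_apply, gibbsBoundary_eq hφ, gibbsBoundary_eq hφ,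
        gibbsSum_congr β φ Λ f hT, gibbsSum_congr β φ Λ 1 hT]
    rw [h1]
    exact (hcont.measurable.comp (measurable_glue_outside Λ 1)).aestronglyMeasurable

theorem SatisfiesDLR.integral_gibbsBoundary {β : ℝ} {ν : Measure (Conf d q)}
    [IsProbabilityMeasure ν] (h : φ.SatisfiesDLR β ν) (Λ : Finset (Lattice d))
    (f : C(Conf d q, ℂ)) : ∫ σ, φ.gibbsBoundary β Λ f σ ∂ν = ∫ σ, f σ ∂ν := by
  rw [← integral_congr_ae (h Λ f), integral_condExp (outsideSigma_le Λ)]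

end Interaction

/-! ### From the Gibbs-Araki-Ion condition to the DLR equations -/

theorem norm_starAlgHom_le (τ : CStarG d q →⋆ₐ[ℂ] CStarG d q) (a : CStarG d q) :
    ‖τ a‖ ≤ ‖a‖ :=
  let _ := cstarAlgebra d q
  NonUnitalStarAlgHom.norm_apply_le τ a

theorem continuous_starAlgHom (τ : CStarG d q →⋆ₐ[ℂ] CStarG d q) : Continuous τ :=
  AddMonoidHomClass.continuous_of_bound τ 1 fun a => by
    rw [one_mul]
    exact norm_starAlgHom_le τ a

namespace Interaction

variable {φ : Interaction d q}

/-- The generator vanishes on functions, since they commute with a classical interaction; hence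
the dynamics fixes them. -/
theorem IsDynamics.apply_ofCont_of_mem {τ : ℝ → (CStarG d q →⋆ₐ[ℂ] CStarG d q)}
    (hτ : φ.IsDynamics τ) (hcl : φ.IsClassical) {Λ : Finset (Lattice d)} {c : C(Conf d q, ℂ)}
    (hc : ofCont c ∈ localAlg d q (Λ : Set (Lattice d))) (t : ℝ) :
    τ t (ofCont c) = ofCont c := by
  have hD : φ.derivation Λ (ofCont c) = 0 := by
    have h0 : ∀ X, φ.toFun X * ofCont c - ofCont c * φ.toFun X = 0 := fun X => by
      rw [← hcl.ofCont_condE X, ← ofCont_mul, ← ofCont_mul, mul_comm, sub_self]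
    simp [derivation, h0]
  have h0 := hτ.generator Λ _ hc
  rw [hD] at h0
  have hderiv : ∀ s, HasDerivAt (fun t => τ t (ofCont c)) 0 s := fun s => by
    have h1 : HasDerivAt (fun r : ℝ => r - s) 1 s := (hasDerivAt_id s).sub_const s
    have h2 : HasDerivAt (fun r => τ (r - s) (ofCont c)) 0 s := by
      have := HasDerivAt.scomp s (h := fun r : ℝ => r - s) (by simpa using h0) h1
      simpa [Function.comp_def] using this
    let L : CStarG d q →L[ℝ] CStarG d q :=
      { toFun := τ s
        map_add' := _root_.map_add (τ s)
        map_smul' := fun r a => by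
          rw [← algebraMap_smul ℂ r a, map_smul]
          simp
        cont := continuous_starAlgHom (τ s) }
    have h3 := L.hasFDerivAt.comp_hasDerivAt s h2
    rw [_root_.map_zero] at h3
    have heq : (fun t => τ t (ofCont c)) = L ∘ fun r => τ (r - s) (ofCont c) := by
      funext r
      rw [Function.comp_apply]
      change _ = τ s _
      rw [← hτ.map_add, add_sub_cancel]
    rw [heq]
    exact h3
  rw [is_const_of_deriv_eq_zero (fun s => (hderiv s).differentiableAt)
    (fun s => (hderiv s).deriv) t 0, hτ.map_zero]

theorem IsDynamics.apply_surfaceEnergy {τ : ℝ → (CStarG d q →⋆ₐ[ℂ] CStarG d q)}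
    (hτ : φ.IsDynamics τ) (hφ : φ.IsSummable) (hcl : φ.IsClassical) (Λ : Finset (Lattice d))
    (t : ℝ) : τ t (φ.surfaceEnergy Λ) = φ.surfaceEnergy Λ := by
  rw [surfaceEnergy, (hφ.summable_straddling Λ).of_norm.map_tsum (τ t)
    (continuous_starAlgHom (τ t))]
  refine tsum_congr fun X => ?_
  have h := φ.isLocal X.1
  rw [← hcl.ofCont_condE X.1] at h ⊢
  exact hτ.apply_ofCont_of_mem hcl h t

/-- The Araki-Dyson series for `P = -W_Λ` sums to `e^{β W_Λ / 2}`. -/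
theorem isArakiDyson_iff {τ : ℝ → (CStarG d q →⋆ₐ[ℂ] CStarG d q)}
    (hτ : φ.IsDynamics τ) (hφ : φ.IsSummable) (hcl : φ.IsClassical) {β : ℝ} (hβ : 0 < β)
    (Λ : Finset (Lattice d)) (E : CStarG d q) :
    IsArakiDyson τ (-φ.surfaceEnergy Λ) (β / 2) E ↔
      E = ofCont (expCont ((β / 2 : ℂ) • φ.surfaceFun Λ)) := by
  rw [isArakiDyson_iff_of_invariant (fun t => by
    rw [map_neg, hτ.apply_surfaceEnergy hφ hcl]) (by positivity), surfaceEnergy_eq hφ hcl,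
    smul_neg, neg_smul, neg_neg, ← ofCont_smul, exp_ofCont]
  push_cast
  rfl

theorem star_expCont_surfaceFun (hφ : φ.IsSummable) (β : ℝ) (Λ : Finset (Lattice d)) :
    star (expCont ((β / 2 : ℂ) • φ.surfaceFun Λ)) = expCont ((β / 2 : ℂ) • φ.surfaceFun Λ) := by
  ext σ
  rw [ContinuousMap.star_apply, expCont_apply, ContinuousMap.smul_apply, surfaceFun_apply hφ,
    RCLike.star_def, ← Complex.exp_conj, show (β / 2 : ℂ) = ((β / 2 : ℝ) : ℂ) by push_cast; rfl,
    smul_eq_mul, map_mul, Complex.conj_ofReal, Complex.conj_ofReal]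

/-- Functions of the configuration outside `Λ`, obtained by freezing the configuration inside
`Λ` to the trivial one, as elements of `C*(𝒢_{Λᶜ})`. -/
def outsideFun (Λ : Finset (Lattice d)) :
    C(Conf d q, ℂ) →ₗ[ℂ] localAlg d q ((Λ : Set (Lattice d))ᶜ) where
  toFun c := ⟨ofCont (c.comp ⟨glue Λ 1, continuous_glue Λ 1⟩), ofCont_mem_localAlg
    fun σ σ' h => by
      change c (glue Λ 1 σ) = c (glue Λ 1 σ')
      rw [glue_congr 1 h]⟩
  map_add' c c' := Subtype.ext <| by
    change ofCont _ = ofCont _ + ofCont _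
    rw [← ofCont_add]
    rfl
  map_smul' r c := Subtype.ext <| by
    change ofCont _ = r • ofCont _
    rw [← ofCont_smul]
    rfl

theorem coe_outsideFun {Λ : Finset (Lattice d)} {c : C(Conf d q, ℂ)}
    (hc : ∀ σ σ' : Conf d q, (∀ x ∉ Λ, σ x = σ' x) → c σ = c σ') :
    (outsideFun Λ c : CStarG d q) = ofCont c := by
  change ofCont _ = _
  congr 1
  ext σ
  exact hc _ _ fun x hx => glue_of_notMem _ _ hx

open scoped Classical in
/-- The function `(σ, g') ↦ 1` if `σ_Λ = s` and `g' = g`, and `0` otherwise. -/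
def matrixUnit (Λ : Finset (Lattice d)) (s : Λ → Spin q) (g : Flip d q) : C_c(Arrow d q, ℂ) :=
  mkCc (fun σ g' => if (fun x : Λ => σ x) = s ∧ g' = g then 1 else 0)
    (fun g' => (continuous_of_discreteTopology
      (f := fun s' : Λ → Spin q => if s' = s ∧ g' = g then (1 : ℂ) else 0)).comp
        (continuous_pi fun x => continuous_apply x.1))
    {g} (by
      intro σ g' hg
      rw [if_neg]
      simpa using fun _ => by simpa using hg)

open scoped Classical in
theorem matrixUnit_apply (Λ : Finset (Lattice d)) (s : Λ → Spin q) (g : Flip d q)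
    (σ : Conf d q) (g' : Flip d q) :
    matrixUnit Λ s g (σ, g') = if (fun x : Λ => σ x) = s ∧ g' = g then 1 else 0 := rfl

theorem isLocal_matrixUnit {Λ : Finset (Lattice d)} (s : Λ → Spin q) {g : Flip d q}
    (hg : g.supp ⊆ Λ) : IsLocal (Λ : Set (Lattice d)) (matrixUnit Λ s g) := by
  refine ⟨fun σ g' hg' => ?_, fun σ σ' g' h => ?_⟩
  · rw [matrixUnit_apply, if_neg]
    rintro ⟨-, rfl⟩
    exact hg' hg
  · have h1 : (fun x : Λ => σ x) = fun x : Λ => σ' x := funext fun x => h x x.2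
    rw [matrixUnit_apply, matrixUnit_apply, h1]

/-- The function `η ↦ f(σ_Λ η_{Λᶜ}, g)` with `σ_Λ = s`. -/
def boundarySlice (Λ : Finset (Lattice d)) (f : C_c(Arrow d q, ℂ)) (s : Λ → Spin q)
    (g : Flip d q) : C(Conf d q, ℂ) :=
  ⟨fun η => f (glue Λ s η, g), (continuous_left f g).comp (continuous_glue Λ s)⟩

theorem boundarySlice_apply (Λ : Finset (Lattice d)) (f : C_c(Arrow d q, ℂ)) (s : Λ → Spin q)
    (g : Flip d q) (η : Conf d q) : boundarySlice Λ f s g η = f (glue Λ s η, g) := rfl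

theorem coe_outsideFun_boundarySlice (Λ : Finset (Lattice d)) (f : C_c(Arrow d q, ℂ))
    (s : Λ → Spin q) (g : Flip d q) :
    (outsideFun Λ (boundarySlice Λ f s g) : CStarG d q) = ofCont (boundarySlice Λ f s g) :=
  coe_outsideFun fun σ σ' h => by
    rw [boundarySlice_apply, boundarySlice_apply, glue_congr s h]

/-- Since `Ω_Λ` is finite, every element of `C_c(𝒢)` is a finite sum of products of an element
carrying the dependence on `σ_Λ` and `g`, and a function of `σ_{Λᶜ}`. -/
theorem ofCc_eq_sum (Λ : Finset (Lattice d)) (f : C_c(Arrow d q, ℂ)) {S : Finset (Flip d q)}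
    (hS : flips f ⊆ S) :
    ofCc f = ∑ s : Λ → Spin q, ∑ g ∈ S,
      ofCc (matrixUnit Λ s g) * ofCont (boundarySlice Λ f s g) := by
  classical
  have h1 : ∀ (s : Λ → Spin q) (g : Flip d q) (ξ : GHilbert d q) (σ : Conf d q) (k : Flip d q),
      (ofCc (matrixUnit Λ s g) * ofCont (boundarySlice Λ f s g) : CStarG d q).1 ξ (σ, k) =
        if (fun x : Λ => ((g⁻¹ * k) • σ) x) = s then
          f ((g⁻¹ * k) • σ, g) * ξ (σ, g⁻¹ * k) else 0 := by
    intro s g ξ σ k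
    change rep (matrixUnit Λ s g) (rep (unitExt (boundarySlice Λ f s g)) ξ) (σ, k) = _
    rw [rep_apply_of_subset _ {g} (flips_subset_of _ _ fun σ g' hg' => by
      rw [matrixUnit_apply, if_neg]
      exact fun h => hg' (Finset.mem_singleton.2 h.2)), Finset.sum_singleton, matrixUnit_apply,
      rep_unitExt_apply, boundarySlice_apply]
    by_cases hs : (fun x : Λ => ((g⁻¹ * k) • σ) x) = s
    · rw [if_pos ⟨hs, rfl⟩, if_pos hs, one_mul, ← hs, glue_restrict]
    · rw [if_neg fun h => hs h.1, if_neg hs, zero_mul]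
  refine Subtype.ext ?_
  ext ξ ⟨σ, k⟩
  let ev : CStarG d q →+ ℂ :=
    { toFun := fun a => a.1 ξ (σ, k)
      map_zero' := rfl
      map_add' := fun _ _ => rfl }
  have h2 : ∀ s g, ev (ofCc (matrixUnit Λ s g) * ofCont (boundarySlice Λ f s g)) =
        if (fun x : Λ => ((g⁻¹ * k) • σ) x) = s then
          f ((g⁻¹ * k) • σ, g) * ξ (σ, g⁻¹ * k) else 0 := fun s g => h1 s g ξ σ k
  change ev (ofCc f) = ev _
  simp only [map_sum, h2]
  rw [Finset.sum_comm]
  simp only [Finset.sum_ite_eq, Finset.mem_univ, if_true]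
  exact rep_apply_of_subset f S hS ξ σ k

theorem IsClassical.trace_matrixUnit_mul_exp (hcl : φ.IsClassical) (β : ℝ)
    (Λ : Finset (Lattice d)) (s : Λ → Spin q) (g : Flip d q) [Decidable (g = 1)] :
    trace Λ (ofCc (matrixUnit Λ s g) * NormedSpace.exp ((-β : ℂ) • φ.hamiltonian Λ)) =
      if g = 1 then Complex.exp (-β * φ.bulkFun Λ (glue Λ s 1)) else 0 := by
  classical
  have hr : ∀ s' : Λ → Spin q, (fun x : Λ => glue Λ s' (1 : Conf d q) x) = s' := fun s' =>
    funext fun x => glue_of_mem s' 1 x.2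
  rw [hcl.trace_mul_exp]
  simp only [condE_ofCc, matrixUnit_apply, hr]
  split_ifs with hg
  · subst hg
    simp
  · refine Finset.sum_eq_zero fun s' _ => ?_
    rw [if_neg fun h => hg h.2.symm, zero_mul]

set_option maxHeartbeats 1000000 in
/-- The product property of the perturbed state determines `μ`, on arrows that flip only spins in
`Λ`, by the values on the diagonal, in the form of Gibbs weights followed by a linear functional
of the boundary condition. -/
theorem exists_eq_gibbsSum {β : ℝ} (hφ : φ.IsSummable) (hcl : φ.IsClassical)
    {μ : CStarG d q →L[ℂ] ℂ} {Λ : Finset (Lattice d)}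
    {μ' : localAlg d q ((Λ : Set (Lattice d))ᶜ) →L[ℂ] ℂ} (hμ' : IsState μ')
    (hprod : ∀ a ∈ localAlg d q (Λ : Set (Lattice d)),
      ∀ b : localAlg d q ((Λ : Set (Lattice d))ᶜ),
        perturbed μ (ofCont (expCont ((β / 2 : ℂ) • φ.surfaceFun Λ))) (a * b) =
          φ.gibbsFree β Λ a * μ' b) :
    ∃ (K : ℂ) (ℓ : C(Conf d q, ℂ) →ₗ[ℂ] ℂ), ∀ f : C_c(Arrow d q, ℂ),
      (∀ g ∈ flips f, g.supp ⊆ Λ) →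
        μ (ofCc f) = K * ℓ (gibbsSum β φ Λ (𝔼 (ofCc f))) := by
  classical
  set e := expCont ((β / 2 : ℂ) • φ.surfaceFun Λ) with he
  set e' := expCont ((-(β / 2) : ℂ) • φ.surfaceFun Λ) with he'
  set Z := trace Λ (NormedSpace.exp ((-β : ℂ) • φ.hamiltonian Λ)) with hZ
  have hZ0 : Z ≠ 0 := hcl.trace_exp_ne_zero β Λ
  have hee : ∀ σ, e σ * e' σ = 1 := fun σ => by
    rw [he, he', expCont_apply, expCont_apply, ← Complex.exp_add]
    simp
  have hstar : star (ofCont e) = ofCont e := by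
    rw [← ofCont_star, star_expCont_surfaceFun hφ]
  have hμE : μ (star (ofCont e) * ofCont e) ≠ 0 := by
    intro h0
    have h1 := hprod 1 (one_mem _) 1
    rw [perturbed, h0, div_zero, gibbsFree, one_mul, div_self hZ0, hμ'.map_one] at h1
    norm_num at h1
  have hprod' : ∀ a ∈ localAlg d q (Λ : Set (Lattice d)),
      ∀ b : localAlg d q ((Λ : Set (Lattice d))ᶜ), μ (ofCont e * (a * b) * ofCont e) =
        μ (star (ofCont e) * ofCont e) * (φ.gibbsFree β Λ a * μ' b) := by
    intro a ha b
    rw [← hprod a ha b, perturbed, mul_div_cancel₀ _ hμE, hstar]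
  let ℓ : C(Conf d q, ℂ) →ₗ[ℂ] ℂ := μ'.toLinearMap ∘ₗ outsideFun Λ
  have hℓ : ∀ c, μ' (outsideFun Λ c) = ℓ c := fun _ => rfl
  refine ⟨μ (star (ofCont e) * ofCont e) / Z, ℓ, fun f hf => ?_⟩
  -- Strip the factors `e^{β W_Λ / 2}` from both sides of `f`.
  let f' : C_c(Arrow d q, ℂ) := mkCc (fun σ g => e' (g • σ) * f (σ, g) * e' σ)
    (fun g => (((map_continuous e').comp (Flip.continuous_smul g)).mul (continuous_left f g)).mul
      (map_continuous e')) (flips f) (fun σ g hg => by rw [apply_eq_zero f hg, mul_zero, zero_mul])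
  have hf'a : ∀ σ g, f' (σ, g) = e' (g • σ) * f (σ, g) * e' σ := fun _ _ => rfl
  have hff' : ofCc f = ofCont e * ofCc f' * ofCont e := by
    refine ofCont_mul_ofCc_mul_ofCont e e f' f fun σ g => ?_
    rw [hf'a]
    linear_combination (-f (σ, g)) * hee (g • σ) - f (σ, g) * e (g • σ) * e' (g • σ) * hee σ
  have hsub : flips f' ⊆ insert 1 (flips f) := flips_subset_of _ _ fun σ g hg => by
    rw [hf'a, apply_eq_zero f fun h => hg (Finset.mem_insert_of_mem h), mul_zero, zero_mul]
  have hsupp : ∀ g ∈ insert 1 (flips f), g.supp ⊆ (Λ : Set (Lattice d)) := by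
    intro g hg
    rcases Finset.mem_insert.1 hg with rfl | hg
    · exact fun x hx => absurd (Flip.one_val x) hx
    · exact hf g hg
  have hterm : ∀ (s : Λ → Spin q), ∀ g ∈ insert 1 (flips f),
      μ (ofCont e * (ofCc (matrixUnit Λ s g) * ofCont (boundarySlice Λ f' s g)) * ofCont e) =
        if g = 1 then μ (star (ofCont e) * ofCont e) / Z *
          (Complex.exp (-β * φ.bulkFun Λ (glue Λ s 1)) *
            ℓ (boundarySlice Λ f' s 1)) else 0 := by
    intro s g hg
    rw [← coe_outsideFun_boundarySlice, hprod' _ (ofCc_mem_localAlg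
      (isLocal_matrixUnit s (hsupp g hg))), gibbsFree, hcl.trace_matrixUnit_mul_exp, ← hZ, hℓ]
    split_ifs with h1
    · subst h1
      ring
    · simp
  have hsum : μ (ofCc f) = ∑ s : Λ → Spin q, ∑ g ∈ insert 1 (flips f),
      μ (ofCont e * (ofCc (matrixUnit Λ s g) * ofCont (boundarySlice Λ f' s g)) * ofCont e) := by
    rw [hff', ofCc_eq_sum Λ f' hsub]
    simp only [Finset.mul_sum, Finset.sum_mul, map_sum]
  rw [hsum]
  have hsum' : ∀ s : Λ → Spin q, ∑ g ∈ insert 1 (flips f),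
      μ (ofCont e * (ofCc (matrixUnit Λ s g) * ofCont (boundarySlice Λ f' s g)) * ofCont e) =
      μ (star (ofCont e) * ofCont e) / Z * (Complex.exp (-β * φ.bulkFun Λ (glue Λ s 1)) *
        ℓ (boundarySlice Λ f' s 1)) := by
    intro s
    rw [Finset.sum_congr rfl (hterm s), Finset.sum_ite_eq' _ _ _,
      if_pos (Finset.mem_insert_self _ _)]
  simp_rw [hsum']
  rw [← Finset.mul_sum]
  congr 1
  have hG : gibbsSum β φ Λ (𝔼 (ofCc f)) = ∑ s : Λ → Spin q,
      Complex.exp (-β * φ.bulkFun Λ (glue Λ s 1)) • boundarySlice Λ f' s 1 := by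
    ext η
    rw [gibbsSum_apply, ContinuousMap.sum_apply]
    refine Finset.sum_congr rfl fun s _ => ?_
    have hb : φ.bulkFun Λ (glue Λ s 1) = φ.bulkFun Λ (glue Λ s η) :=
      hcl.bulkFun_congr fun x hx => by rw [glue_of_mem s _ hx, glue_of_mem s _ hx]
    rw [ContinuousMap.smul_apply, boundarySlice_apply, hf'a, one_smul, condE_ofCc, he',
      expCont_apply, hb, mul_add, Complex.exp_add, smul_eq_mul, ContinuousMap.smul_apply,
      smul_eq_mul]
    have hw : Complex.exp (-β * φ.surfaceFun Λ (glue Λ s η)) =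
        Complex.exp (-(β / 2) * φ.surfaceFun Λ (glue Λ s η)) *
          Complex.exp (-(β / 2) * φ.surfaceFun Λ (glue Λ s η)) := by
      rw [← Complex.exp_add]
      ring_nf
    rw [hw]
    ring
  rw [hG, map_sum]
  refine Finset.sum_congr rfl fun s _ => ?_
  rw [map_smul, smul_eq_mul]

theorem exists_finset_supp_subset (f : C_c(Arrow d q, ℂ)) :
    ∃ Λ : Finset (Lattice d), ∀ g ∈ flips f, g.supp ⊆ Λ := by
  classical
  refine ⟨(flips f).biUnion fun g => g.finite_supp.toFinset, fun g hg x hx => ?_⟩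
  exact Finset.mem_coe.2 (Finset.mem_biUnion.2 ⟨g, hg, by simpa using hx⟩)

end Interaction

open Interaction in
/-- A state with the Gibbs-Araki-Ion condition is classical and its Riesz-Markov measure satisfies
the DLR equations. -/
theorem GibbsArakiIon.isClassicalState_and_satisfiesDLR {β : ℝ} (hβ : 0 < β)
    {φ : Interaction d q} (hφ : φ.IsSummable) (hcl : φ.IsClassical)
    {μ : CStarG d q →L[ℂ] ℂ} (hμ : IsState μ) (h : GibbsArakiIon β φ μ) :
    IsClassicalState μ ∧ ∃ ν, IsRieszMarkov μ ν ∧ φ.SatisfiesDLR β ν := by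
  obtain ⟨-, τ, hτ, hP⟩ := h
  have key : ∀ Λ : Finset (Lattice d), ∃ (K : ℂ) (ℓ : C(Conf d q, ℂ) →ₗ[ℂ] ℂ),
      ∀ f : C_c(Arrow d q, ℂ), (∀ g ∈ flips f, g.supp ⊆ Λ) →
        μ (ofCc f) = K * ℓ (gibbsSum β φ Λ (𝔼 (ofCc f))) := by
    intro Λ
    obtain ⟨E, hE, μ', hμ', hprod⟩ := hP Λ
    rw [isArakiDyson_iff hτ hφ hcl hβ] at hE
    subst hE
    exact exists_eq_gibbsSum hφ hcl hμ' hprod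
  have hunit : ∀ (Λ : Finset (Lattice d)) (c : C(Conf d q, ℂ)),
      ∀ g ∈ flips (unitExt c), g.supp ⊆ Λ := by
    intro Λ c g hg x hx
    have hg1 : g ∈ ({1} : Finset (Flip d q)) := flips_subset_of (unitExt c) {1}
      (fun σ g hg => by rw [unitExt_apply, if_neg (by simpa using hg)]) hg
    rw [Finset.mem_singleton.1 hg1] at hx
    exact absurd (Flip.one_val x) hx
  refine ⟨fun a => ?_, ?_⟩
  · have hclosed : IsClosed {a : CStarG d q | μ a = μ (ofCont (𝔼 a))} :=
      isClosed_eq μ.continuous (μ.continuous.comp (continuous_ofCont.comp continuous_condE))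
    refine denseRange_ofCc.induction_on (p := fun a => μ a = μ (ofCont (𝔼 a))) a hclosed
      fun f => ?_
    obtain ⟨Λ, hΛ⟩ := exists_finset_supp_subset f
    obtain ⟨K, ℓ, hK⟩ := key Λ
    rw [hK f hΛ, ofCont, hK _ (hunit Λ _)]
    congr 3
    exact (condE_ofCont (𝔼 (ofCc f))).symm
  · obtain ⟨ν, hν⟩ := hμ.exists_isRieszMarkov
    have hprob : IsProbabilityMeasure ν := hν.1
    refine ⟨ν, hν, satisfiesDLR_of_integral_eq hφ ν fun Λ f g hg => ?_⟩
    obtain ⟨K, ℓ, hK⟩ := key Λ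
    have hcont := continuous_gibbsBoundary hφ β Λ f
    have hint : ∀ F : C(Conf d q, ℂ), ∫ σ, F σ ∂ν = K * ℓ (gibbsSum β φ Λ F) := fun F => by
      rw [hν.2, ofCont, hK _ (hunit Λ F)]
      congr 3
      exact condE_ofCont F
    have h1 := hint (g * ⟨φ.gibbsBoundary β Λ f, hcont⟩)
    have h2 := hint (g * f)
    have h3 : gibbsSum β φ Λ (g * ⟨φ.gibbsBoundary β Λ f, hcont⟩) = gibbsSum β φ Λ (g * f) := by
      ext η
      have hgl : ∀ s : Λ → Spin q, ∀ x ∉ Λ, glue Λ s η x = η x := fun s x hx =>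
        glue_of_notMem s η hx
      have hL : gibbsSum β φ Λ (g * ⟨φ.gibbsBoundary β Λ f, hcont⟩) η =
          g η * φ.gibbsBoundary β Λ f η * gibbsSum β φ Λ 1 η := by
        rw [gibbsSum_apply, gibbsSum_apply, Finset.mul_sum]
        refine Finset.sum_congr rfl fun s _ => ?_
        have hG : φ.gibbsBoundary β Λ f (glue Λ s η) = φ.gibbsBoundary β Λ f η := by
          rw [gibbsBoundary_eq hφ, gibbsBoundary_eq hφ, gibbsSum_congr β φ Λ f (hgl s),
            gibbsSum_congr β φ Λ 1 (hgl s)]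
        change g (glue Λ s η) * φ.gibbsBoundary β Λ f (glue Λ s η) * _ = _
        rw [hG, hg _ _ (hgl s), ContinuousMap.one_apply, one_mul]
      have hR : gibbsSum β φ Λ (g * f) η = g η * gibbsSum β φ Λ f η := by
        rw [gibbsSum_apply, gibbsSum_apply, Finset.mul_sum]
        refine Finset.sum_congr rfl fun s _ => ?_
        rw [ContinuousMap.mul_apply, hg _ _ (hgl s), mul_assoc]
      rw [hL, hR, gibbsBoundary_eq hφ, mul_assoc,
        div_mul_cancel₀ _ (gibbsSum_one_ne_zero hφ β Λ η)]
    rw [h3, ← h2] at h1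
    exact h1

/-! ### The dynamics of a classical interaction -/

namespace Interaction

/-- The energy difference `∑_X (φ_X(gσ) - φ_X(σ))` along an arrow `(σ, g)`. The sum converges for a
summable classical interaction, because the terms with `X` disjoint from `supp g` vanish. -/
def relEnergy (φ : Interaction d q) (p : Arrow d q) : ℝ :=
  ∑' X : Finset (Lattice d), (φ.value X (p.2 • p.1) - φ.value X p.1)

variable {φ : Interaction d q}

theorem IsClassical.value_congr (hcl : φ.IsClassical) {X : Finset (Lattice d)} {σ σ' : Conf d q}
    (h : ∀ x ∈ X, σ x = σ' x) : φ.value X σ = φ.value X σ' := by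
  rw [value, value, hcl.condE_congr h]

theorem abs_value_le (X : Finset (Lattice d)) (σ : Conf d q) : |φ.value X σ| ≤ ‖φ.toFun X‖ :=
  (Complex.abs_re_le_norm _).trans
    (((𝔼 (φ.toFun X)).norm_coe_le_norm σ).trans (norm_condE_le _))

theorem IsSummable.summable_value_meeting (hφ : φ.IsSummable) (Λ : Finset (Lattice d))
    (σ : Conf d q) :
    Summable fun X : {X : Finset (Lattice d) // ∃ x ∈ X, x ∈ Λ} => φ.value X σ :=
  Summable.of_norm_bounded (hφ.summable_meeting Λ) fun X => abs_value_le X.1 σ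

/-- Only the `φ_X` with `X` meeting `supp g` contribute to the energy difference. -/
theorem relEnergy_eq (hφ : φ.IsSummable) (hcl : φ.IsClassical) {Λ : Finset (Lattice d)}
    (σ : Conf d q) {g : Flip d q} (hg : g.supp ⊆ Λ) :
    (φ.relEnergy (σ, g) : ℂ) = φ.meetingFun Λ (g • σ) - φ.meetingFun Λ σ := by
  rw [meetingFun_apply hφ, meetingFun_apply hφ, ← Complex.ofReal_sub,
    ← (hφ.summable_value_meeting Λ _).tsum_sub (hφ.summable_value_meeting Λ _), relEnergy]
  congr 1
  refine (tsum_subtype_eq_of_support_subset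
    (f := fun X => φ.value X (g • σ) - φ.value X σ)
    (s := {X : Finset (Lattice d) | ∃ x ∈ X, x ∈ Λ}) fun X hX => ?_).symm
  by_contra hn
  refine hX (sub_eq_zero.2 (hcl.value_congr fun x hx => ?_))
  have h1 : g.val x = 1 := by
    by_contra h
    exact hn ⟨x, hx, hg h⟩
  rw [Flip.smul_apply, h1, one_mul]

/-- The cocycle property of the energy difference. -/
theorem relEnergy_sub (hφ : φ.IsSummable) (hcl : φ.IsClassical) (σ : Conf d q)
    (k g : Flip d q) :
    (φ.relEnergy (σ, k) : ℂ) - φ.relEnergy (σ, g⁻¹ * k) =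
      φ.relEnergy ((g⁻¹ * k) • σ, g) := by
  classical
  let Λ : Finset (Lattice d) := k.finite_supp.toFinset ∪ (g⁻¹ * k).finite_supp.toFinset ∪
    g.finite_supp.toFinset
  have hk : k.supp ⊆ Λ := fun x hx => by simp [Λ, hx]
  have hgk : (g⁻¹ * k).supp ⊆ Λ := fun x hx => by simp [Λ, hx]
  have hg : g.supp ⊆ Λ := fun x hx => by simp [Λ, hx]
  rw [relEnergy_eq hφ hcl σ hk, relEnergy_eq hφ hcl σ hgk, relEnergy_eq hφ hcl _ hg, smul_smul,
    mul_inv_cancel_left]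
  ring

variable (φ) in
/-- The diagonal unitary on `ℓ²(𝒢)` with entries `e^{i t (H(kσ) - H(σ))}`. -/
def evolution (t : ℝ) : GHilbert d q →L[ℂ] GHilbert d q :=
  weighted (fun p => Complex.exp ((t * φ.relEnergy p : ℝ) * Complex.I)) 1
    (fun _ => (Complex.norm_exp_ofReal_mul_I _).le) (Equiv.refl _)

theorem evolution_apply (t : ℝ) (ξ : GHilbert d q) (p : Arrow d q) :
    φ.evolution t ξ p = Complex.exp ((t * φ.relEnergy p : ℝ) * Complex.I) * ξ p := rfl

theorem evolution_zero : φ.evolution 0 = 1 := by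
  ext ξ p
  rw [evolution_apply, zero_mul, Complex.ofReal_zero, zero_mul, Complex.exp_zero, one_mul]
  rfl

theorem evolution_add (s t : ℝ) : φ.evolution (s + t) = φ.evolution s * φ.evolution t := by
  ext ξ p
  change _ = φ.evolution s (φ.evolution t ξ) p
  rw [evolution_apply, evolution_apply, evolution_apply, ← mul_assoc, ← Complex.exp_add]
  congr 2
  push_cast
  ring

theorem evolution_mul_neg (t : ℝ) : φ.evolution t * φ.evolution (-t) = 1 := by
  rw [← evolution_add, add_neg_cancel, evolution_zero]

theorem evolution_neg_mul (t : ℝ) : φ.evolution (-t) * φ.evolution t = 1 := by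
  rw [← evolution_add, neg_add_cancel, evolution_zero]

theorem star_evolution (t : ℝ) : star (φ.evolution t) = φ.evolution (-t) := by
  symm
  rw [ContinuousLinearMap.star_eq_adjoint, ContinuousLinearMap.eq_adjoint_iff]
  intro ξ η
  rw [lp.inner_eq_tsum, lp.inner_eq_tsum]
  refine tsum_congr fun p => ?_
  rw [evolution_apply, evolution_apply, RCLike.inner_apply, RCLike.inner_apply, map_mul,
    ← Complex.exp_conj, map_mul, Complex.conj_ofReal, Complex.conj_I]
  push_cast
  ring_nf

variable (φ) in
/-- The unitary element `e^{i t ∑_{X ∩ Λ ≠ ∅} φ_X}` of `C(Ω)`, which implements the dynamics on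
`C*(𝒢_Λ)`. -/
def localUnitary (Λ : Finset (Lattice d)) (t : ℝ) : C(Conf d q, ℂ) :=
  expCont ((t * Complex.I : ℂ) • φ.meetingFun Λ)

theorem evolution_conj_rep (hφ : φ.IsSummable) (hcl : φ.IsClassical) {Λ : Finset (Lattice d)}
    {f : C_c(Arrow d q, ℂ)} (hf : ∀ g ∈ flips f, g.supp ⊆ Λ) (t : ℝ) :
    φ.evolution t * rep f * φ.evolution (-t) =
      (ofCont (φ.localUnitary Λ t) * ofCc f * ofCont (φ.localUnitary Λ (-t)) : CStarG d q).1 := by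
  ext ξ ⟨σ, k⟩
  change φ.evolution t (rep f (φ.evolution (-t) ξ)) (σ, k) =
    rep (unitExt (φ.localUnitary Λ t))
      (rep f (rep (unitExt (φ.localUnitary Λ (-t))) ξ)) (σ, k)
  rw [evolution_apply, rep_unitExt_apply, rep_apply_of_subset f _ subset_rfl,
    rep_apply_of_subset f _ subset_rfl, Finset.mul_sum, Finset.mul_sum]
  refine Finset.sum_congr rfl fun g hg => ?_
  rw [evolution_apply, rep_unitExt_apply]
  have h1 := relEnergy_sub hφ hcl σ k g
  rw [relEnergy_eq hφ hcl _ (hf g hg), smul_smul, mul_inv_cancel_left] at h1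
  have h2 : Complex.exp ((t * φ.relEnergy (σ, k) : ℝ) * Complex.I) *
      Complex.exp ((-t * φ.relEnergy (σ, g⁻¹ * k) : ℝ) * Complex.I) =
      φ.localUnitary Λ t (k • σ) * φ.localUnitary Λ (-t) ((g⁻¹ * k) • σ) := by
    rw [localUnitary, localUnitary, expCont_apply, expCont_apply, ← Complex.exp_add,
      ← Complex.exp_add, ContinuousMap.smul_apply, ContinuousMap.smul_apply, smul_eq_mul,
      smul_eq_mul]
    congr 1
    push_cast
    linear_combination t * Complex.I * h1
  linear_combination f ((g⁻¹ * k) • σ, g) * ξ (σ, g⁻¹ * k) * h2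

theorem evolution_conj_mem (hφ : φ.IsSummable) (hcl : φ.IsClassical) (t : ℝ) (a : CStarG d q) :
    φ.evolution t * a.1 * φ.evolution (-t) ∈ (repAlg d q Set.univ).topologicalClosure := by
  refine denseRange_ofCc.induction_on
    (p := fun a : CStarG d q => φ.evolution t * a.1 * φ.evolution (-t) ∈
      (repAlg d q Set.univ).topologicalClosure) a ?_ fun f => ?_
  · exact (StarSubalgebra.isClosed_topologicalClosure (repAlg d q Set.univ)).preimage
      ((continuous_const.mul continuous_subtype_val).mul continuous_const)
  · obtain ⟨Λ, hΛ⟩ := exists_finset_supp_subset f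
    change φ.evolution t * rep f * φ.evolution (-t) ∈ _
    rw [evolution_conj_rep hφ hcl hΛ]
    exact Subtype.property _

/-- The dynamics of a summable classical interaction, implemented on `ℓ²(𝒢)` by conjugation with
the diagonal unitaries `evolution`. -/
def dynamics (hφ : φ.IsSummable) (hcl : φ.IsClassical) (t : ℝ) :
    CStarG d q →⋆ₐ[ℂ] CStarG d q where
  toFun a := ⟨φ.evolution t * a.1 * φ.evolution (-t), evolution_conj_mem hφ hcl t a⟩
  map_one' := Subtype.ext <| by
    change φ.evolution t * 1 * φ.evolution (-t) = 1
    rw [mul_one, evolution_mul_neg]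
  map_mul' a b := Subtype.ext <| by
    change φ.evolution t * (a.1 * b.1) * φ.evolution (-t) =
      φ.evolution t * a.1 * φ.evolution (-t) * (φ.evolution t * b.1 * φ.evolution (-t))
    calc φ.evolution t * (a.1 * b.1) * φ.evolution (-t)
        = φ.evolution t * a.1 * 1 * b.1 * φ.evolution (-t) := by simp only [mul_assoc, mul_one]
      _ = _ := by
        rw [← evolution_neg_mul (φ := φ) t]
        simp only [mul_assoc]
  map_zero' := Subtype.ext <| by
    change φ.evolution t * 0 * φ.evolution (-t) = 0
    rw [mul_zero, zero_mul]
  map_add' a b := Subtype.ext <| by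
    change φ.evolution t * (a.1 + b.1) * φ.evolution (-t) =
      φ.evolution t * a.1 * φ.evolution (-t) + φ.evolution t * b.1 * φ.evolution (-t)
    rw [mul_add, add_mul]
  commutes' c := Subtype.ext <| by
    change φ.evolution t * algebraMap ℂ _ c * φ.evolution (-t) = algebraMap ℂ _ c
    rw [← Algebra.commutes, mul_assoc, evolution_mul_neg, mul_one]
  map_star' a := Subtype.ext <| by
    change φ.evolution t * star a.1 * φ.evolution (-t) =
      star (φ.evolution t * a.1 * φ.evolution (-t))
    rw [star_mul, star_mul, star_evolution, star_evolution, neg_neg, mul_assoc]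

theorem dynamics_ofCc (hφ : φ.IsSummable) (hcl : φ.IsClassical) {Λ : Finset (Lattice d)}
    {f : C_c(Arrow d q, ℂ)} (hf : ∀ g ∈ flips f, g.supp ⊆ Λ) (t : ℝ) :
    dynamics hφ hcl t (ofCc f) =
      ofCont (φ.localUnitary Λ t) * ofCc f * ofCont (φ.localUnitary Λ (-t)) :=
  Subtype.ext (evolution_conj_rep hφ hcl hf t)

theorem dynamics_of_mem_localAlg (hφ : φ.IsSummable) (hcl : φ.IsClassical)
    {Λ : Finset (Lattice d)} {a : CStarG d q} (ha : a ∈ localAlg d q (Λ : Set (Lattice d)))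
    (t : ℝ) :
    dynamics hφ hcl t a =
      ofCont (φ.localUnitary Λ t) * a * ofCont (φ.localUnitary Λ (-t)) := by
  refine localAlg_induction (p := fun a => dynamics hφ hcl t a =
      ofCont (φ.localUnitary Λ t) * a * ofCont (φ.localUnitary Λ (-t)))
    (isClosed_eq (continuous_starAlgHom _)
      ((continuous_const.mul continuous_id).mul continuous_const)) (fun f hf => ?_) ha
  refine dynamics_ofCc hφ hcl (fun g hg => ?_) t
  by_contra hn
  obtain ⟨σ, hσ⟩ : ∃ σ, f (σ, g) ≠ 0 := by simpa [flips] using hg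
  exact hσ (hf.1 σ g hn)

theorem ofCont_localUnitary (Λ : Finset (Lattice d)) (t : ℝ) :
    ofCont (φ.localUnitary Λ t) =
      NormedSpace.exp (t • (Complex.I • ofCont (φ.meetingFun Λ))) := by
  rw [localUnitary, ← exp_ofCont, ofCont_smul, mul_smul, Complex.coe_smul]

theorem hasDerivAt_ofCont_localUnitary (Λ : Finset (Lattice d)) (t : ℝ) :
    HasDerivAt (fun t => ofCont (φ.localUnitary Λ t))
      (ofCont (φ.localUnitary Λ t) * (Complex.I • ofCont (φ.meetingFun Λ))) t := by
  simp only [ofCont_localUnitary]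
  exact hasDerivAt_exp_smul_const (𝕂 := ℝ) _ t

theorem continuous_dynamics (hφ : φ.IsSummable) (hcl : φ.IsClassical) (a : CStarG d q) :
    Continuous fun t => dynamics hφ hcl t a := by
  refine continuous_of_uniform_approx_of_continuous fun u hu => ?_
  obtain ⟨ε, hε, hεu⟩ := Metric.mem_uniformity_dist.1 hu
  obtain ⟨f, hf⟩ := denseRange_ofCc.exists_dist_lt a hε
  obtain ⟨Λ, hΛ⟩ := exists_finset_supp_subset f
  refine ⟨fun t => dynamics hφ hcl t (ofCc f), ?_, fun t => hεu ?_⟩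
  · simp only [dynamics_ofCc hφ hcl hΛ]
    have hc : Continuous fun t => ofCont (φ.localUnitary Λ t) :=
      continuous_iff_continuousAt.2 fun t =>
        (hasDerivAt_ofCont_localUnitary (φ := φ) Λ t).continuousAt
    exact (hc.mul continuous_const).mul (hc.comp continuous_neg)
  · rw [dist_eq_norm, ← map_sub]
    exact (norm_starAlgHom_le (dynamics hφ hcl t) (a - ofCc f)).trans_lt (by rwa [← dist_eq_norm])

theorem derivation_eq (hφ : φ.IsSummable) (hcl : φ.IsClassical) (Λ : Finset (Lattice d))
    (a : CStarG d q) :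
    φ.derivation Λ a = Complex.I •
      (ofCont (φ.meetingFun Λ) * a - a * ofCont (φ.meetingFun Λ)) := by
  have hs : Summable fun X : {X : Finset (Lattice d) // ∃ x ∈ X, x ∈ Λ} => φ.toFun X :=
    (hφ.summable_meeting Λ).of_norm
  have h : ofCont (φ.meetingFun Λ) =
      ∑' X : {X : Finset (Lattice d) // ∃ x ∈ X, x ∈ Λ}, φ.toFun X := by
    rw [meetingFun, ← coe_ofContHom,
      (hφ.summable_condE_meeting Λ).map_tsum (ofContHom d q) continuous_ofCont]
    exact tsum_congr fun X => hcl.ofCont_condE X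
  rw [derivation, h, ← hs.tsum_mul_right, ← hs.tsum_mul_left,
    (hs.mul_right a).tsum_sub (hs.mul_left a)]

theorem isDynamics_dynamics (hφ : φ.IsSummable) (hcl : φ.IsClassical) :
    φ.IsDynamics (dynamics hφ hcl) where
  map_zero a := Subtype.ext <| by
    change φ.evolution 0 * a.1 * φ.evolution (-0) = a.1
    rw [neg_zero, evolution_zero, one_mul, mul_one]
  map_add s t a := Subtype.ext <| by
    change φ.evolution (s + t) * a.1 * φ.evolution (-(s + t)) =
      φ.evolution s * (φ.evolution t * a.1 * φ.evolution (-t)) * φ.evolution (-s)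
    rw [neg_add_rev, evolution_add, evolution_add]
    simp only [mul_assoc]
  continuous := continuous_dynamics hφ hcl
  generator Λ a ha := by
    simp only [dynamics_of_mem_localAlg hφ hcl ha]
    rw [derivation_eq hφ hcl]
    have h1 := hasDerivAt_ofCont_localUnitary (φ := φ) Λ 0
    have h2 : HasDerivAt (fun t : ℝ => ofCont (φ.localUnitary Λ (-t)))
        (-(ofCont (φ.localUnitary Λ 0) * (Complex.I • ofCont (φ.meetingFun Λ)))) 0 := by
      have h := hasDerivAt_ofCont_localUnitary (φ := φ) Λ (-0)
      simpa [Function.comp_def] using h.scomp (0 : ℝ) (hasDerivAt_neg (0 : ℝ))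
    have h0 : ofCont (φ.localUnitary Λ 0) = (1 : CStarG d q) := by
      rw [ofCont_localUnitary, zero_smul, NormedSpace.exp_zero]
    have h3 := (h1.mul_const a).mul h2
    rw [neg_zero, h0, one_mul, one_mul, mul_one] at h3
    have hD : Complex.I • (ofCont (φ.meetingFun Λ) * a - a * ofCont (φ.meetingFun Λ)) =
        Complex.I • ofCont (φ.meetingFun Λ) * a + a * -(Complex.I • ofCont (φ.meetingFun Λ)) := by
      rw [mul_neg, smul_mul_assoc, mul_smul_comm, smul_sub, sub_eq_add_neg]
    rw [hD]
    exact h3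

end Interaction

/-! ### Faithfulness and independence -/

open scoped Classical in
/-- The unit vector `δ_p` of `ℓ²(𝒢)`. -/
def basisVec (p : Arrow d q) : GHilbert d q := lp.single 2 p 1

/-- Right translation by `k`: the operator `ξ ↦ ((σ, h) ↦ ξ(kσ, h k⁻¹))`. -/
def rightTranslate (k : Flip d q) : GHilbert d q →L[ℂ] GHilbert d q :=
  weighted (fun _ => 1) 1 (fun _ => by simp)
    { toFun := fun p => (k • p.1, p.2 * k⁻¹)
      invFun := fun p => (k⁻¹ • p.1, p.2 * k)
      left_inv := fun p => by simp
      right_inv := fun p => by simp }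

theorem rightTranslate_apply (k : Flip d q) (ξ : GHilbert d q) (σ : Conf d q) (h : Flip d q) :
    rightTranslate k ξ (σ, h) = ξ (k • σ, h * k⁻¹) := by
  rw [rightTranslate, weighted_apply, one_mul]
  rfl

theorem rightTranslate_basisVec (σ : Conf d q) (k : Flip d q) :
    rightTranslate k (basisVec (k • σ, 1)) = basisVec (σ, k) := by
  classical
  ext ⟨σ', h⟩
  rw [rightTranslate_apply, basisVec, basisVec, lp.single_apply, lp.single_apply,
    Pi.single_apply, Pi.single_apply]
  congr 1
  simp [mul_inv_eq_one]

theorem commute_rightTranslate (k : Flip d q) (a : CStarG d q) :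
    rightTranslate k * a.1 = a.1 * rightTranslate k := by
  refine denseRange_ofCc.induction_on
    (p := fun a : CStarG d q => rightTranslate k * a.1 = a.1 * rightTranslate k) a
    (isClosed_eq (continuous_const.mul continuous_subtype_val)
      (continuous_subtype_val.mul continuous_const)) fun f => ?_
  ext ξ ⟨σ, h⟩
  change rightTranslate k (rep f ξ) (σ, h) = rep f (rightTranslate k ξ) (σ, h)
  rw [rightTranslate_apply, rep_apply_of_subset f _ subset_rfl,
    rep_apply_of_subset f _ subset_rfl]
  refine Finset.sum_congr rfl fun g _ => ?_
  rw [rightTranslate_apply, smul_smul, mul_assoc g⁻¹, mul_assoc g⁻¹, mul_assoc h,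
    inv_mul_cancel, mul_one]

/-- The conditional expectation is faithful: `𝔼(a^* a)(σ) = ‖a δ_{(σ,1)}‖²`, and right translations
carry the vectors `δ_{(σ,1)}` to all basis vectors. -/
theorem eq_zero_of_condE_star_mul_self {a : CStarG d q} (h : 𝔼 (star a * a) = 0) : a = 0 := by
  classical
  have h1 : ∀ σ, a.1 (basisVec (σ, 1)) = 0 := fun σ => by
    have h2 : 𝔼 (star a * a) σ = 0 := by rw [h, ContinuousMap.zero_apply]
    rw [condE_apply, diagEntry] at h2
    change inner ℂ (basisVec (σ, 1)) (star a.1 (a.1 (basisVec (σ, 1)))) = 0 at h2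
    rw [ContinuousLinearMap.star_eq_adjoint, ContinuousLinearMap.adjoint_inner_right,
      inner_self_eq_zero] at h2
    exact h2
  have h2 : ∀ p, a.1 (basisVec p) = 0 := by
    rintro ⟨σ, k⟩
    rw [← rightTranslate_basisVec]
    change (a.1 * rightTranslate k) _ = 0
    rw [← commute_rightTranslate]
    change rightTranslate k (a.1 _) = 0
    rw [h1, map_zero]
  refine Subtype.ext ?_
  ext1 ξ
  have h3 := (lp.hasSum_single (p := 2) (by norm_num) ξ).mapL a.1
  have h4 : ∀ p, a.1 (lp.single 2 p (ξ p)) = 0 := fun p => by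
    have : (lp.single 2 p (ξ p) : GHilbert d q) = ξ p • basisVec p := by
      rw [basisVec, ← lp.single_smul, smul_eq_mul, mul_one]
    rw [this, map_smul, h2, smul_zero]
  simp only [h4] at h3
  exact h3.unique hasSum_zero

theorem condE_congr_of_mem_localAlg {Λ : Set (Lattice d)} {a : CStarG d q}
    (ha : a ∈ localAlg d q Λ) {σ σ' : Conf d q} (h : ∀ x ∈ Λ, σ x = σ' x) :
    𝔼 a σ = 𝔼 a σ' := by
  refine localAlg_induction (p := fun a => 𝔼 a σ = 𝔼 a σ')
    (isClosed_eq ((ContinuousEvalConst.continuous_eval_const σ).comp continuous_condE)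
      ((ContinuousEvalConst.continuous_eval_const σ').comp continuous_condE)) (fun f hf => ?_) ha
  rw [condE_ofCc, condE_ofCc, hf.2 σ σ' 1 h]

theorem condE_mul_of_isLocal {Λ : Set (Lattice d)} {f g : C_c(Arrow d q, ℂ)}
    (hf : IsLocal Λ f) (hg : IsLocal Λᶜ g) :
    𝔼 (ofCc f * ofCc g) = 𝔼 (ofCc f) * 𝔼 (ofCc g) := by
  ext σ
  rw [← ofCc_conv, ContinuousMap.mul_apply, condE_ofCc, condE_ofCc, condE_ofCc, conv_apply,
    Finset.sum_eq_single 1]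
  · simp
  · intro h _ hne
    by_cases h1 : h.supp ⊆ Λ
    · by_cases h2 : (h⁻¹ * 1).supp ⊆ Λᶜ
      · refine absurd (Subtype.ext (funext fun x => ?_)) hne
        by_contra hx
        refine h2 (fun hx' => hx ?_) (h1 hx)
        rw [mul_one, Flip.inv_val, inv_eq_one] at hx'
        exact hx'
      · rw [hg.1 _ _ h2, mul_zero]
    · rw [hf.1 _ _ h1, zero_mul]
  · intro h
    rw [apply_eq_zero f h, zero_mul]

/-- The conditional expectation is multiplicative on commuting local algebras, since a flip and
its inverse can be supported in disjoint sets only if they are trivial. -/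
theorem condE_mul_of_mem_localAlg {Λ : Set (Lattice d)} {a b : CStarG d q}
    (ha : a ∈ localAlg d q Λ) (hb : b ∈ localAlg d q Λᶜ) :
    𝔼 (a * b) = 𝔼 a * 𝔼 b := by
  have hcl : ∀ b : CStarG d q, IsClosed {a : CStarG d q | 𝔼 (a * b) = 𝔼 a * 𝔼 b} :=
    fun b => isClosed_eq (continuous_condE.comp (continuous_mul_const b))
      (continuous_condE.mul continuous_const)
  have hcr : ∀ a : CStarG d q, IsClosed {b : CStarG d q | 𝔼 (a * b) = 𝔼 a * 𝔼 b} :=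
    fun a => isClosed_eq (continuous_condE.comp (continuous_const_mul a))
      (continuous_const.mul continuous_condE)
  exact localAlg_induction (p := fun a => 𝔼 (a * b) = 𝔼 a * 𝔼 b) (hcl b)
    (fun f hf => localAlg_induction (p := fun b => 𝔼 (ofCc f * b) = 𝔼 (ofCc f) * 𝔼 b)
      (hcr (ofCc f)) (fun g hg => condE_mul_of_isLocal hf hg) hb) ha

/-! ### From the DLR equations to the Gibbs-Araki-Ion condition -/

namespace Interaction

variable {φ : Interaction d q}

/-- A measure satisfying the DLR equations has full support. If `f ≥ 0` has integral zero, then so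
does its Gibbs average in any finite `Λ`, and since Gibbs weights are positive `f` vanishes at some
configuration agreeing with `σ` on `Λ`; these configurations converge to `σ` as `Λ` grows. -/
theorem SatisfiesDLR.eq_zero_of_integral_eq_zero (hφ : φ.IsSummable) {β : ℝ}
    {ν : Measure (Conf d q)} [IsProbabilityMeasure ν] (h : φ.SatisfiesDLR β ν)
    {f : C(Conf d q, ℂ)} (hf : ∀ σ, 0 ≤ f σ) (h0 : ∫ σ, f σ ∂ν = 0) (σ : Conf d q) :
    f σ = 0 := by
  have hre : ∀ σ, (((f σ).re : ℝ) : ℂ) = f σ := fun σ =>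
    Complex.ext rfl (Complex.le_def.1 (hf σ)).2
  have hf0 : ∀ σ, 0 ≤ (f σ).re := fun σ => (Complex.le_def.1 (hf σ)).1
  have hex : ∀ Λ : Finset (Lattice d), ∃ η, f (glue Λ (fun x => σ x) η) = 0 := by
    intro Λ
    let G : Conf d q → ℝ := fun η =>
      (∑ s : Λ → Spin q, (f (glue Λ s η)).re * Real.exp (-β * φ.energy Λ (glue Λ s η))) /
        ∑ s : Λ → Spin q, Real.exp (-β * φ.energy Λ (glue Λ s η))
    have hG : ∀ η, φ.gibbsBoundary β Λ f η = (G η : ℂ) := fun η => by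
      simp only [gibbsBoundary, G]
      push_cast
      simp only [hre]
    have hG0 : ∀ η, 0 ≤ G η := fun η => div_nonneg
      (Finset.sum_nonneg fun s _ => mul_nonneg (hf0 _) (Real.exp_pos _).le)
      (sum_exp_energy_pos β φ Λ η).le
    have hGc : Continuous G := by
      have h1 : G = fun η => (φ.gibbsBoundary β Λ f η).re := by
        funext η
        rw [hG, Complex.ofReal_re]
      rw [h1]
      exact Complex.continuous_re.comp (continuous_gibbsBoundary hφ β Λ f)
    have hint : ∫ η, G η ∂ν = 0 := by
      have h1 := h.integral_gibbsBoundary Λ f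
      rw [h0] at h1
      simp only [hG] at h1
      rw [integral_complex_ofReal] at h1
      exact_mod_cast h1
    have hGi : Integrable G ν :=
      hGc.integrable_of_hasCompactSupport (HasCompactSupport.of_compactSpace _)
    have hae := (integral_eq_zero_iff_of_nonneg hG0 hGi).1 hint
    obtain ⟨η, hη⟩ := hae.exists
    refine ⟨η, ?_⟩
    have hη' : G η = 0 := hη
    rw [div_eq_zero_iff, or_iff_left (sum_exp_energy_pos β φ Λ η).ne',
      Finset.sum_eq_zero_iff_of_nonneg
        fun s _ => mul_nonneg (hf0 _) (Real.exp_pos _).le] at hη'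
    have h2 := hη' (fun x => σ x) (Finset.mem_univ _)
    rw [mul_eq_zero, or_iff_left (Real.exp_pos _).ne'] at h2
    rw [← hre, h2, Complex.ofReal_zero]
  choose η hη using hex
  have hlim : Tendsto (fun Λ : Finset (Lattice d) => glue Λ (fun x => σ x) (η Λ)) atTop
      (𝓝 σ) := by
    refine tendsto_pi_nhds.2 fun x => tendsto_const_nhds.congr' ?_
    filter_upwards [eventually_ge_atTop {x}] with Λ hΛ
    rw [glue_of_mem _ _ (hΛ (Finset.mem_singleton_self x))]
  have h1 := ((map_continuous f).tendsto σ).comp hlim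
  refine tendsto_nhds_unique h1 ?_
  simp only [Function.comp_def, hη]
  exact tendsto_const_nhds

/-- The DLR equations separate the inside of `Λ`, carrying the Gibbs weight of `H_Λ`, from the
outside once the surface energy is removed. -/
theorem SatisfiesDLR.integral_product (hφ : φ.IsSummable) (hcl : φ.IsClassical) {β : ℝ}
    {ν : Measure (Conf d q)} [IsProbabilityMeasure ν] (h : φ.SatisfiesDLR β ν)
    {Λ : Finset (Lattice d)} {a b : CStarG d q} (ha : a ∈ localAlg d q (Λ : Set (Lattice d)))
    (hb : b ∈ localAlg d q ((Λ : Set (Lattice d))ᶜ)) :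
    ∫ σ, 𝔼 (a * b) σ * Complex.exp (β * φ.surfaceFun Λ σ) ∂ν =
      trace Λ (a * NormedSpace.exp ((-β : ℂ) • φ.hamiltonian Λ)) *
        ∫ η, 𝔼 b η / gibbsSum β φ Λ 1 η ∂ν := by
  let F : C(Conf d q, ℂ) :=
    ⟨fun σ => 𝔼 (a * b) σ * Complex.exp (β * φ.surfaceFun Λ σ), by fun_prop⟩
  change ∫ σ, F σ ∂ν = _
  rw [← h.integral_gibbsBoundary Λ F, ← integral_const_mul]
  congr 1
  funext η
  rw [gibbsBoundary_eq hφ, hcl.trace_mul_exp, ← mul_div_assoc]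
  congr 1
  rw [gibbsSum_apply, Finset.sum_mul]
  refine Finset.sum_congr rfl fun s _ => ?_
  change 𝔼 (a * b) (glue Λ s η) * _ * _ = _
  have h1 : ∀ x ∈ (Λ : Set (Lattice d)), glue Λ s η x = glue Λ s 1 x := fun x hx => by
    rw [glue_of_mem s _ hx, glue_of_mem s _ hx]
  have h2 : ∀ x ∈ (Λ : Set (Lattice d))ᶜ, glue Λ s η x = η x := fun x hx =>
    glue_of_notMem s η hx
  rw [condE_mul_of_mem_localAlg ha hb, ContinuousMap.mul_apply,
    condE_congr_of_mem_localAlg ha h1, condE_congr_of_mem_localAlg hb h2,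
    hcl.bulkFun_congr h1, mul_add, Complex.exp_add]
  have h3 : Complex.exp (β * φ.surfaceFun Λ (glue Λ s η)) *
      Complex.exp (-β * φ.surfaceFun Λ (glue Λ s η)) = 1 := by
    rw [← Complex.exp_add]
    simp
  linear_combination 𝔼 a (glue Λ s 1) * 𝔼 b η *
    Complex.exp (-β * φ.bulkFun Λ (glue Λ s 1)) * h3

end Interaction

open Interaction in
theorem gibbsArakiIon_of_satisfiesDLR {β : ℝ} (hβ : 0 < β)
    {φ : Interaction d q} (hφ : φ.IsSummable) (hcl : φ.IsClassical)
    {μ : CStarG d q →L[ℂ] ℂ} (hμ : IsState μ) (hclass : IsClassicalState μ)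
    {ν : Measure (Conf d q)} (hν : IsRieszMarkov μ ν) (hDLR : φ.SatisfiesDLR β ν) :
    GibbsArakiIon β φ μ := by
  have hprob : IsProbabilityMeasure ν := hν.1
  have hμν : ∀ a, μ a = ∫ σ, 𝔼 a σ ∂ν := fun a => by rw [hclass a, hν.2]
  have hfaithful : ∀ a, μ (star a * a) = 0 → a = 0 := fun a h0 => by
    refine eq_zero_of_condE_star_mul_self (ContinuousMap.ext fun σ => ?_)
    refine hDLR.eq_zero_of_integral_eq_zero hφ (fun σ => ?_) ((hμν _).symm.trans h0) σ
    rw [condE_apply, diagEntry]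
    change 0 ≤ inner ℂ (basisVec (σ, 1)) (star a.1 (a.1 (basisVec (σ, 1))))
    rw [ContinuousLinearMap.star_eq_adjoint, ContinuousLinearMap.adjoint_inner_right]
    rw [inner_self_eq_norm_sq_to_K]
    exact pow_nonneg (Complex.zero_le_real.2 (norm_nonneg (a.1 (basisVec (σ, 1))))) 2
  refine ⟨hfaithful, dynamics hφ hcl, isDynamics_dynamics hφ hcl, fun Λ => ?_⟩
  set e := expCont ((β / 2 : ℂ) • φ.surfaceFun Λ) with he
  have hstar : star (ofCont e) = ofCont e := by
    rw [← ofCont_star, star_expCont_surfaceFun hφ]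
  refine ⟨ofCont e, (isArakiDyson_iff (isDynamics_dynamics hφ hcl) hφ hcl hβ Λ _).2 rfl, ?_⟩
  set M := μ (star (ofCont e) * ofCont e) with hM
  have hM0 : M ≠ 0 := fun h0 => by
    have h1 := congrArg 𝔼 (hfaithful _ h0)
    rw [condE_ofCont, map_zero] at h1
    exact Complex.exp_ne_zero _ (DFunLike.congr_fun h1 1)
  have hMpos : 0 < M := lt_of_le_of_ne (hμ.pos _) hM0.symm
  let L : CStarG d q →L[ℂ] CStarG d q :=
    (ContinuousLinearMap.mul ℂ (CStarG d q) (star (ofCont e))).comp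
      ((ContinuousLinearMap.mul ℂ (CStarG d q)).flip (ofCont e))
  have hL : ∀ x, L x = star (ofCont e) * x * ofCont e := fun x => (mul_assoc _ _ _).symm
  let ι : localAlg d q ((Λ : Set (Lattice d))ᶜ) →L[ℂ] CStarG d q :=
    (Subalgebra.toSubmodule (localAlg d q ((Λ : Set (Lattice d))ᶜ)).toSubalgebra).subtypeL
  let μ' : localAlg d q ((Λ : Set (Lattice d))ᶜ) →L[ℂ] ℂ := M⁻¹ • (μ.comp (L.comp ι))
  have hμ'a : ∀ b, μ' b = M⁻¹ * μ (star (ofCont e) * b * ofCont e) := fun b => by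
    rw [← hL]
    rfl
  refine ⟨μ', ⟨fun b => ?_, ?_⟩, fun a ha b => ?_⟩
  · rw [hμ'a]
    refine mul_nonneg (inv_nonneg.2 hMpos.le) ?_
    have h1 : star (ofCont e) * ((star b * b : localAlg d q ((Λ : Set (Lattice d))ᶜ)) :
        CStarG d q) * ofCont e = star (b.1 * ofCont e) * (b.1 * ofCont e) := by
      rw [star_mul]
      simp only [mul_assoc]
      rfl
    rw [h1]
    exact hμ.pos _
  · rw [hμ'a]
    change M⁻¹ * μ (star (ofCont e) * 1 * ofCont e) = 1
    rw [mul_one, ← hM, inv_mul_cancel₀ hM0]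
  · have hE : ∀ x, μ (star (ofCont e) * x * ofCont e) =
        ∫ σ, 𝔼 x σ * Complex.exp (β * φ.surfaceFun Λ σ) ∂ν := fun x => by
      rw [hμν, hstar, condE_mul_ofCont, condE_ofCont_mul]
      congr 1
      funext σ
      have h1 : e σ * e σ = Complex.exp (β * φ.surfaceFun Λ σ) := by
        rw [he, expCont_apply, ← Complex.exp_add, ContinuousMap.smul_apply, smul_eq_mul]
        ring_nf
      rw [← h1, ContinuousMap.mul_apply, ContinuousMap.mul_apply]
      ring
    have hb1 := hDLR.integral_product hφ hcl (one_mem (localAlg d q (Λ : Set (Lattice d)))) b.2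
    rw [one_mul, one_mul, ← hE] at hb1
    have hZ0 := hcl.trace_exp_ne_zero β Λ
    rw [perturbed, hμ'a, hE, hDLR.integral_product hφ hcl ha b.2, hb1, gibbsFree, ← hM]
    field_simp

end QSpin

end

theorem mainTheorem1 (d q : ℕ) [NeZero q] (β : ℝ) (hβ : 0 < β) (φ : QSpin.Interaction d q)
    (hφ : φ.IsSummable) (hcl : φ.IsClassical)
    (μ : QSpin.CStarG d q →L[ℂ] ℂ) (hμ : QSpin.IsState μ) :
    QSpin.GibbsArakiIon β φ μ ↔
      QSpin.IsClassicalState μ ∧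
        ∃ ν : MeasureTheory.Measure (QSpin.Conf d q),
          QSpin.IsRieszMarkov μ ν ∧ φ.SatisfiesDLR β ν := by
  constructor
  · intro h
    exact h.isClassicalState_and_satisfiesDLR hβ hφ hcl hμ
  · rintro ⟨hclass, ν, hν, hDLR⟩
    exact QSpin.gibbsArakiIon_of_satisfiesDLR hβ hφ hcl hμ hclass hν hDLR
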